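/- Let $q$ be a prime power. In $\mathrm{PG}(2,q^2)$ use homogeneous coordinates $(x_0,x_1,x_2)$ and affine coordinates $x=x_1/x_0$, $y=x_2/x_0$, and put $Y_\infty=(0,0,1)$. For $a,b\in \mathrm{GF}(q^2)$ put $$U_{a,b}=\{(1,x,ax^2+bx^{q+1}+r)\mid x\in \mathrm{GF}(q^2),\ r\in \mathrm{GF}(q)\}\cup\{Y_\infty\},\qquad \mathcal U_b=U_{0,b}.$$ A *unital* in a projective plane of order $q^2$ is a set of $q^3+1$ points which meets every line in $1$ or $q+1$ points. A unital of $\mathrm{PG}(2,q^2)$ is *classical* if it is the set of absolute points of a non-degenerate unitary polarity. A *B-M unital* of $\mathrm{PG}(2,q^2)$ is a point set obtained, for some choice of the line at infinity $\ell_\infty$ and in the Bruck–Bose representation of the plane in $\mathrm{PG}(4,q)$ with respect to $\ell_\infty$, from a cone over an elliptic quadric whose vertex lies in the solid at infinity, outside the three-dimensional subspace spanned by the quadric, and which meets the solid at infinity exactly in a line of the spread passing through the vertex: the set consists of the affine points represented on the cone and of the point of $\ell_\infty$ represented by that spread line. It is of *H-Sz type* if $q$ is odd and it is the union of $q$ non-degenerate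 conics sharing a point. The pair $(a,b)$ satisfies *Ebert's discriminant condition* if, for $q$ odd, $4a^{q+1}+(b^q-b)^2$ is a non-square in $\mathrm{GF}(q)$ and, for $q$ even, $b\notin \mathrm{GF}(q)$ and $\mathrm{Tr}\bigl(a^{q+1}/(b^q+b)^2\bigr)=0$, where $\mathrm{Tr}$ is the trace $\mathrm{GF}(q)\to \mathrm{GF}(2)$. For $a\ne 0$ let $\mathfrak A_a$ be the affine plane whose points are those of $\mathrm{AG}(2,q^2)$ and whose lines are the vertical lines $x=k$ and the parabolas $y=ax^2+mx+d$ with $k,m,d\in \mathrm{GF}(q^2)$. The infinite point of its vertical lines is identified with $Y_\infty$, so that $\mathcal U_b$ is also a point set of the projective closure of $\mathfrak A_a$. **Theorem.** Let $a\in \mathrm{GF}(q^2)\setminus\{0\}$ and $b\in \mathrm{GF}(q^2)\setminus \mathrm{GF}(q)$ be such that $(a,b)$ satisfies Ebert's discriminant condition. Then $\mathcal U_b$ is a classical unital of $\mathrm{PG}(2,q^2)$ and a unital in the projective closure of $\mathfrak A_a$. There is an isomorphism from this closure onto $\mathrm{PG}(2,q^2)$ which maps each affine point $(x,y)$ to $(1,x,y-ax^2)$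 and fixes $Y_\infty$; it maps $\mathcal U_b$ onto $U_{-a,b}$, and $U_{-a,b}$ is a non-classical B-M unital. Conversely, every non-classical B-M unital of $\mathrm{PG}(2,q^2)$ that is not of H-Sz type is obtained in this way, up to a projectivity: it is the image, under a projectivity of $\mathrm{PG}(2,q^2)$, of $\mathcal U_b$ regarded (through the above isomorphism) as a point set in the projective closure of $\mathfrak A_a$, for some $a\in\mathrm{GF}(q^2)\setminus\{0\}$ and $b\in \mathrm{GF}(q^2)\setminus \mathrm{GF}(q)$ such that $(a,b)$ satisfies Ebert's discriminant condition. -/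

import Mathlib

open scoped LinearAlgebra.Projectivization

/-! Throughout, `K` plays the role of `GF(q)` and `F` that of `GF(q²)`, a quadratic extension
of the finite field `K`; so `q = Fintype.card K`. -/

/-- The point set of `PG(2,F)`, with homogeneous coordinates `(x₀, x₁, x₂)`. -/
abbrev PG2 (F : Type*) [Field F] : Type _ := ℙ F (Fin 3 → F)

/-- The lines of `PG(2,F)`: the sets `c₀x₀ + c₁x₁ + c₂x₂ = 0` with `c ≠ 0`. -/
def pg2Lines (F : Type*) [Field F] : Set (Set (PG2 F)) :=
  {l | ∃ c : Fin 3 → F, c ≠ 0 ∧ l = {p | c ⬝ᵥ p.rep = 0}}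

/-- The affine point `(x, y)`, that is, the point `(1, x, y)` of `PG(2,F)`. -/
def affPt {F : Type*} [Field F] (x y : F) : PG2 F :=
  Projectivization.mk F ![1, x, y] (fun h => one_ne_zero (congrFun h 0))

/-- The infinite point `Y_∞ = (0, 0, 1)` of the vertical lines. -/
def yInf (F : Type*) [Field F] : PG2 F :=
  Projectivization.mk F ![0, 0, 1] (fun h => one_ne_zero (congrFun h 2))

/-- The projectivity (linear collineation) of `PG(2,F)` induced by `g`. -/
def projectivity {F : Type*} [Field F] (g : (Fin 3 → F) ≃ₗ[F] (Fin 3 → F)) : PG2 F → PG2 F :=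
  Projectivization.map g.toLinearMap g.injective

/-! ### Projective closure of an affine plane -/

/-- The parallel class of `l`: the lines which are equal to `l` or disjoint from it. -/
def parallelClass {P : Type*} (L : Set (Set P)) (l : Set P) : Set (Set P) :=
  {m | m ∈ L ∧ (m = l ∨ Disjoint m l)}

/-- The points of the projective closure of the plane with line set `L`: the points of the
plane, together with one point at infinity for each parallel class. -/
abbrev ClosurePoint {P : Type*} (L : Set (Set P)) : Type _ :=
  P ⊕ {C : Set (Set P) // ∃ l ∈ L, C = parallelClass L l}

/-- The lines of the projective closure: every line `l` of the plane extended by the point at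
infinity of its parallel class, and the line at infinity. -/
def closureLines {P : Type*} (L : Set (Set P)) : Set (Set (ClosurePoint L)) :=
  {s | (∃ l ∈ L, s = Sum.inl '' l ∪ Sum.inr '' {C | l ∈ C.1}) ∨ s = Set.range Sum.inr}

/-- `e` is an isomorphism of the planes with line sets `L` and `L'`. -/
def IsPlaneIso {X Y : Type*} (L : Set (Set X)) (L' : Set (Set Y)) (e : X ≃ Y) : Prop :=
  ∀ s : Set X, s ∈ L ↔ e '' s ∈ L'

/-- In a projective plane of order `q²`, a unital is a set of `q³ + 1` points which meets every
line in `1` or `q + 1` points. -/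
def IsUnital {X : Type*} (q : ℕ) (L : Set (Set X)) (S : Set X) : Prop :=
  S.ncard = q ^ 3 + 1 ∧ ∀ l ∈ L, (S ∩ l).ncard = 1 ∨ (S ∩ l).ncard = q + 1

/-! ### The plane of vertical lines and parabolas -/

/-- The vertical line `x = k`. -/
def verticalLine {F : Type*} (k : F) : Set (F × F) := {p | p.1 = k}

/-- The parabola `y = a x² + m x + d`. -/
def parabola {F : Type*} [Field F] (a m d : F) : Set (F × F) :=
  {p | p.2 = a * p.1 ^ 2 + m * p.1 + d}

/-- The lines of the affine plane `𝔄_a`, whose points are those of `AG(2,F)`. -/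
def parabolaPlane {F : Type*} [Field F] (a : F) : Set (Set (F × F)) :=
  {l | (∃ k, l = verticalLine k) ∨ ∃ m d, l = parabola a m d}

/-- The infinite point of the vertical lines in the projective closure of `𝔄_a`; it is
identified with `Y_∞`. -/
def closureYInf {F : Type*} [Field F] (a : F) : ClosurePoint (parabolaPlane a) :=
  Sum.inr ⟨parallelClass (parabolaPlane a) (verticalLine 0),
    verticalLine 0, Or.inl ⟨0, rfl⟩, rfl⟩

/-- `Φ` is the identification of the projective closure of `𝔄_a` with `PG(2,F)` in which the
affine point `(x, y)` has coordinates `(ξ, η) = (x, y - a x²)`. -/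
def IsCoordinatization {F : Type*} [Field F] (a : F)
    (Φ : ClosurePoint (parabolaPlane a) ≃ PG2 F) : Prop :=
  IsPlaneIso (closureLines (parabolaPlane a)) (pg2Lines F) Φ ∧
  (∀ x y : F, Φ (Sum.inl (x, y)) = affPt x (y - a * x ^ 2)) ∧
  Φ (closureYInf a) = yInf F

/-! ### The point sets `U_{a,b}` and `𝒰_b`, and the discriminant condition -/

section Unitals

variable (K : Type*) {F : Type*} [Field K] [Fintype K] [Field F] [Algebra K F]

/-- `U_{a,b} = {(1, x, a x² + b x^{q+1} + r) | x ∈ F, r ∈ K} ∪ {Y_∞}`. -/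
def bmSet (a b : F) : Set (PG2 F) :=
  {p | ∃ (x : F) (r : K),
    p = affPt x (a * x ^ 2 + b * x ^ (Fintype.card K + 1) + algebraMap K F r)} ∪ {yInf F}

/-- `𝒰_b = {(1, x, b x^{q+1} + r) | x ∈ F, r ∈ K} ∪ {Y_∞}`. -/
def classicalSet (b : F) : Set (PG2 F) :=
  {p | ∃ (x : F) (r : K),
    p = affPt x (b * x ^ (Fintype.card K + 1) + algebraMap K F r)} ∪ {yInf F}

/-- `𝒰_b` regarded as a set of points of the projective closure of `𝔄_a`. -/
def classicalSetInClosure (a b : F) : Set (ClosurePoint (parabolaPlane a)) :=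
  Sum.inl '' {p : F × F | affPt p.1 p.2 ∈ classicalSet K b} ∪ {closureYInf a}

/-- Ebert's discriminant condition. For even `q` the trace is the absolute one,
from `K` to `GF(2)`. -/
def EbertCondition (a b : F) : Prop :=
  (Odd (Fintype.card K) → ∃ d : K,
    algebraMap K F d
      = 4 * a ^ (Fintype.card K + 1) + (b ^ Fintype.card K - b) ^ 2 ∧ ¬ IsSquare d) ∧
  (Even (Fintype.card K) → b ∉ Set.range (algebraMap K F) ∧ ∃ d : K,
    algebraMap K F d = a ^ (Fintype.card K + 1) / (b ^ Fintype.card K + b) ^ 2 ∧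
    ∃ _ : CharP K 2, (letI := ZMod.algebra K 2; Algebra.trace (ZMod 2) K d) = 0)

/-- A classical unital of `PG(2,F)`: the absolute points of a non-degenerate unitary polarity,
that is, the zeros of a non-degenerate Hermitian form with respect to `x ↦ x^q`. -/
def IsClassicalUnital (U : Set (PG2 F)) : Prop :=
  ∃ H : Matrix (Fin 3) (Fin 3) F,
    (∀ i j, H j i = H i j ^ Fintype.card K) ∧ H.det ≠ 0 ∧
    U = {p | ∑ i, ∑ j, p.rep i * H i j * p.rep j ^ Fintype.card K = 0}

end Unitals

/-! ### Buekenhout-Metz unitals, from the Bruck-Bose representation -/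

/-- An elliptic quadric in a three-dimensional projective subspace of `ℙ K M`, that is, in the
span of the points given by four linearly independent vectors `v i`: it has canonical equation
`c₀c₁ + f(c₂, c₃) = 0` in the corresponding coordinates, with `f` a binary quadratic form
irreducible over `K`. -/
def IsEllipticQuadricIn {K M : Type*} [Field K] [AddCommGroup M] [Module K M]
    (v : Fin 4 → M) (O : Set (ℙ K M)) : Prop :=
  ∃ α β γ : K, (∀ s t : K, α * s ^ 2 + β * s * t + γ * t ^ 2 = 0 → s = 0 ∧ t = 0) ∧
    O = {p | ∃ c : Fin 4 → K, p.rep = ∑ i, c i • v i ∧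
      c 0 * c 1 + (α * c 2 ^ 2 + β * c 2 * c 3 + γ * c 3 ^ 2) = 0}

/-- The cone with vertex `V` and base `O`: the union of the lines joining `V` to the points
of `O`. -/
def projCone {K M : Type*} [Field K] [AddCommGroup M] [Module K M]
    (V : ℙ K M) (O : Set (ℙ K M)) : Set (ℙ K M) :=
  {p | ∃ o ∈ O, p.submodule ≤ V.submodule ⊔ o.submodule}

section BruckBose

variable (K : Type*) {F : Type*} [Field K] [Field F] [Algebra K F]

/-- The point set of `PG(4,K)`, as the projective space of `K × F × F`. -/
abbrev PG4 (K F : Type*) [Field K] [Field F] [Algebra K F] : Type _ := ℙ K (K × F × F)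

/-- The solid at infinity `Σ_∞` of `PG(4,K)`. -/
def solidAtInfinity (F : Type*) [Field F] [Algebra K F] : Set (PG4 K F) := {p | p.rep.1 = 0}

/-- The point of `PG(4,K)` off `Σ_∞` which represents the affine point `(x, y)`. -/
def bruckBosePt (x y : F) : PG4 K F :=
  Projectivization.mk K ((1 : K), x, y) (fun h => one_ne_zero (congrArg Prod.fst h))

/-- The line of the regular spread of `Σ_∞` which represents the point `(0, u, w)` of the line
at infinity of `AG(2,F)`. -/
def spreadLine (u w : F) : Set (PG4 K F) := {p | ∃ t : F, p.rep = (0, t * u, t * w)}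

/-- `U` arises by the Buekenhout-Metz construction in the Bruck-Bose representation of `PG(2,F)`
in `PG(4,K)` with respect to the line `x₀ = 0`: take a cone over an elliptic quadric, with vertex
a point `V` of `Σ_∞` outside the three-dimensional subspace of the quadric, which meets `Σ_∞`
exactly in a line of the spread through `V`; `U` consists of the affine points represented on the
cone and of the point at infinity represented by that spread line. -/
def IsBuekenhoutMetzSet (U : Set (PG2 F)) : Prop :=
  ∃ (v : Fin 4 → K × F × F) (O : Set (PG4 K F)) (V : PG4 K F) (u w : F)
    (h : (![0, u, w] : Fin 3 → F) ≠ 0),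
    LinearIndependent K v ∧ IsEllipticQuadricIn v O ∧
    V.rep ∉ Submodule.span K (Set.range v) ∧
    V ∈ spreadLine K u w ∧
    projCone V O ∩ solidAtInfinity K F = spreadLine K u w ∧
    U = {p | ∃ x y : F, p = affPt x y ∧ bruckBosePt K x y ∈ projCone V O} ∪
      {Projectivization.mk F ![0, u, w] h}

/-- A B-M unital of `PG(2,F)`: up to a projectivity (that is, with respect to some choice of the
line at infinity and of the coordinates), it arises by the Buekenhout-Metz construction. -/
def IsBMUnital (U : Set (PG2 F)) : Prop :=
  ∃ g : (Fin 3 → F) ≃ₗ[F] (Fin 3 → F), IsBuekenhoutMetzSet K (projectivity g '' U)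

end BruckBose

/-- A non-degenerate conic of `PG(2,F)`, for `F` of odd characteristic. -/
def IsConic {F : Type*} [Field F] (C : Set (PG2 F)) : Prop :=
  ∃ A : Matrix (Fin 3) (Fin 3) F, A.IsSymm ∧ A.det ≠ 0 ∧
    C = {p | p.rep ⬝ᵥ A.mulVec p.rep = 0}

/-- A B-M unital of Hirschfeld-Szőnyi type: `q` is odd and the B-M unital is the union of `q`
conics sharing a point. -/
def IsHSzType (K : Type*) {F : Type*} [Field K] [Fintype K] [Field F] [Algebra K F]
    (U : Set (PG2 F)) : Prop :=
  Odd (Fintype.card K) ∧ IsBMUnital K U ∧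
  ∃ C : Fin (Fintype.card K) → Set (PG2 F),
    Function.Injective C ∧ (∀ i, IsConic (C i)) ∧ (∃ P, ∀ i, P ∈ C i) ∧ U = ⋃ i, C i

/-!
Write `q = |K|` and call `(a, b)` anisotropic if `a x² + b x^{q+1} ∉ K` for all `x ≠ 0`, that is,
if the quadratic form `x ↦ φ (a x² + b x^{q+1})` on the plane `F` over `K` has no nontrivial zero;
here `φ : F → K` is a linear functional with kernel `K`. Everything rests on the equivalence of
this with Ebert's condition (`ebertCondition_iff`). Dividing by `x^{q+1}` and using Hilbert 90, a
nontrivial zero amounts to some `k ∈ K` for which `k - b` and `a` have the same norm, that is, to a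
root in `K` of `X² - (b^q + b) X + b^{q+1} - a^{q+1}`. For odd `q` one looks at the discriminant;
for even `q`, at the Artin–Schreier criterion, the polynomial with `a = 0` having the roots `b` and
`b^q`.

*The plane `𝔄_a`.* The map `(x, y) ↦ (x, y - a x²)` straightens the parabolas to lines and extends
to the closures (`isCoordinatization`), and it carries `𝒰_b` to `U_{-a,b}`. A parabola meets `𝒰_b`
in the zeros of an inhomogeneous quadratic polynomial on `F` with anisotropic leading form `N`.
There is such a zero by the Chevalley–Warning theorem; taking it as origin, the polynomial becomes
`N + μ` with `μ` linear, and the inversion `x ↦ x / N x` sends the remaining zeros to the affine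
line `μ = -1`, which has `q` points or none (`ncard_zeros`).

*The set `U_{a,b}`.* In the Bruck–Bose representation it is the cone
`φ (a x² + b x^{q+1}) = t φ (y)`. If it were the set of zeros of a Hermitian form, comparison along
vertical lines would reduce the form to few terms, and substituting the points
`y = a x² + b x^{q+1}` would give a polynomial of degree at most `2q < q²` which vanishes
identically and has the coefficient `a` at `x²`, up to a nonzero factor
(`not_isClassicalUnital_bmSet`). The case `q = 2` does not occur, because all nonzero elements
of `F` then have norm `1`.

*Converse.* After a projectivity the vertex of the cone is `(0, 0, 1)`. The equation `Q = 0` of the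
cone then depends on `y` through `φ (y)` only, and as its points at infinity form the spread line
`x = 0`, the only term with `y` is `c t φ (y)`, with `c ≠ 0`. Hence `φ (y)` is a quadratic
polynomial in `x` with anisotropic leading form. Every quadratic form on `F` is
`x ↦ φ (a x² + b x^{q+1})` and every linear one is `x ↦ φ (m x)`, so a shear brings the set to
`U_{a,b}` (`exists_image_bmSet_of_isBMUnital`). If `a = 0` this is a Hermitian curve, and if `b ∈ K`
then `q` is odd and it is the union of the `q` conics `y = a x² + r`, `r ∈ K`.
-/

namespace BMUnital

/-! ### The quadratic extension of a finite field -/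

section Coordinates

variable {K F : Type*} [Field K] [Field F] [Algebra K F]

lemma exists_notMem_range (hF : Module.finrank K F = 2) :
    ∃ e : F, e ∉ Set.range (algebraMap K F) := by
  by_contra! h
  have := Algebra.finrank_eq_of_equiv_equiv (RingEquiv.refl K)
    (RingEquiv.ofBijective (algebraMap K F) ⟨(algebraMap K F).injective, h⟩) (by ext; rfl)
  simp [hF] at this

/-- A `K`-linear functional on `F` with kernel `K`, and a complement of `K`. -/
lemma exists_coord (hF : Module.finrank K F = 2) :
    ∃ (e : F) (φ : F →ₗ[K] K), φ e = 1 ∧ (∀ k, φ (algebraMap K F k) = 0) ∧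
      ∀ y, ∃ k, y = algebraMap K F k + φ y • e := by
  obtain ⟨e, he⟩ := exists_notMem_range hF
  have hli : LinearIndependent K ![(1 : F), e] := by
    rw [LinearIndependent.pair_iff]
    intro s t hst
    have ht : t = 0 := by
      by_contra ht
      refine he ⟨-s / t, ?_⟩
      have ht' : algebraMap K F t ≠ 0 := by simpa using ht
      rw [map_div₀, map_neg, div_eq_iff ht']
      simp only [Algebra.smul_def] at hst
      linear_combination -hst
    subst ht
    simpa using hst
  let B := basisOfLinearIndependentOfCardEqFinrank hli (by simp [hF])
  have hB0 : B 0 = 1 := by simp [B]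
  have hB1 : B 1 = e := by simp [B]
  refine ⟨e, B.coord 1, ?_, fun k => ?_, fun y => ⟨B.coord 0 y, ?_⟩⟩
  · rw [← hB1]; simp
  · rw [Algebra.algebraMap_eq_smul_one, ← hB0]; simp
  · conv_lhs => rw [← B.sum_repr y]
    rw [Fin.sum_univ_two, hB0, hB1, Algebra.algebraMap_eq_smul_one]
    rfl

lemma mem_range_iff_coord {e : F} {φ : F →ₗ[K] K} (hk : ∀ k, φ (algebraMap K F k) = 0)
    (hy : ∀ y, ∃ k, y = algebraMap K F k + φ y • e) (y : F) :
    y ∈ Set.range (algebraMap K F) ↔ φ y = 0 := by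
  refine ⟨?_, fun h => ?_⟩
  · rintro ⟨k, rfl⟩
    exact hk k
  · obtain ⟨k, hk⟩ := hy y
    exact ⟨k, by simpa [h] using hk.symm⟩

end Coordinates

section FieldBasics

variable {K F : Type*} [Field K] [Fintype K] [Field F] [Algebra K F]

lemma pow_card_add (x y : F) :
    (x + y) ^ Fintype.card K = x ^ Fintype.card K + y ^ Fintype.card K :=
  map_add (FiniteField.frobeniusAlgHom K F) x y

lemma pow_card_sub (x y : F) :
    (x - y) ^ Fintype.card K = x ^ Fintype.card K - y ^ Fintype.card K :=
  map_sub (FiniteField.frobeniusAlgHom K F) x y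

lemma pow_card_neg (x : F) : (-x) ^ Fintype.card K = -x ^ Fintype.card K :=
  map_neg (FiniteField.frobeniusAlgHom K F) x

lemma pow_card_algebraMap (k : K) : algebraMap K F k ^ Fintype.card K = algebraMap K F k :=
  (FiniteField.frobeniusAlgHom K F).commutes k

lemma card_eq_sq [Fintype F] (hF : Module.finrank K F = 2) :
    Fintype.card F = Fintype.card K ^ 2 := by
  have : Module.Finite K F := Module.finite_of_finrank_pos (by omega)
  rw [Module.card_eq_pow_finrank (K := K) (V := F), hF]

lemma finite_of_finrank_eq_two (hF : Module.finrank K F = 2) : Finite F :=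
  have : Module.Finite K F := Module.finite_of_finrank_pos (by omega)
  Module.finite_of_finite K

lemma pow_card_pow_card (hF : Module.finrank K F = 2) (x : F) :
    (x ^ Fintype.card K) ^ Fintype.card K = x := by
  have := finite_of_finrank_eq_two hF
  have := Fintype.ofFinite F
  rw [← pow_mul, ← sq, ← card_eq_sq hF, FiniteField.pow_card]

/-- The subfield `K` of `F` is the fixed field of `x ↦ x ^ q`. -/
lemma mem_range_iff (x : F) : x ∈ Set.range (algebraMap K F) ↔ x ^ Fintype.card K = x := by
  classical
  refine ⟨?_, fun hx => ?_⟩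
  · rintro ⟨k, rfl⟩
    exact pow_card_algebraMap k
  · -- `X ^ q - X` has at most `q` roots, and the elements of `K` are that many.
    by_contra hn
    have hq : 1 < Fintype.card K := Fintype.one_lt_card
    have hP := FiniteField.X_pow_card_sub_X_ne_zero F hq
    have hsub : insert x (Finset.univ.image (algebraMap K F)) ⊆
        (Polynomial.X ^ Fintype.card K - Polynomial.X : Polynomial F).roots.toFinset := by
      intro y hy
      rw [Multiset.mem_toFinset, Polynomial.mem_roots hP]
      rcases Finset.mem_insert.1 hy with rfl | hy
      · simp [hx]
      · obtain ⟨k, -, rfl⟩ := Finset.mem_image.1 hy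
        simp [pow_card_algebraMap]
    have h1 := (Finset.card_le_card hsub).trans
      ((Multiset.toFinset_card_le _).trans (Polynomial.card_roots' _))
    rw [FiniteField.X_pow_card_sub_X_natDegree_eq F hq, Finset.card_insert_of_notMem (by
      simpa using hn), Finset.card_image_of_injective _ (algebraMap K F).injective,
      Finset.card_univ] at h1
    omega

lemma exists_norm (hF : Module.finrank K F = 2) (x : F) :
    ∃ k : K, algebraMap K F k = x ^ (Fintype.card K + 1) := by
  refine (mem_range_iff (K := K) _).2 ?_
  rw [pow_succ, mul_pow, pow_card_pow_card hF, mul_comm]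

lemma exists_trace (hF : Module.finrank K F = 2) (x : F) :
    ∃ k : K, algebraMap K F k = x ^ Fintype.card K + x := by
  refine (mem_range_iff (K := K) _).2 ?_
  rw [pow_card_add, pow_card_pow_card hF, add_comm]

/-- Hilbert's Theorem 90 for the extension `F` of `K`. -/
lemma exists_mul_pow_card_eq (hF : Module.finrank K F = 2) {w : F}
    (hw : w ^ (Fintype.card K + 1) = 1) : ∃ x : F, x ≠ 0 ∧ w * x ^ Fintype.card K = x := by
  have key : ∀ t : F, w * (t + w * t ^ Fintype.card K) ^ Fintype.card K
      = t + w * t ^ Fintype.card K := by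
    intro t
    rw [pow_card_add, mul_pow, pow_card_pow_card hF]
    rw [pow_succ] at hw
    linear_combination t * hw
  by_contra! h
  have h0 : ∀ t : F, t + w * t ^ Fintype.card K = 0 := fun t => by
    by_contra hne
    exact h _ hne (key t)
  have hw1 := h0 1
  rw [one_pow, mul_one] at hw1
  obtain ⟨e, he⟩ := exists_notMem_range hF
  rw [mem_range_iff] at he
  have := h0 e
  apply he
  linear_combination (e ^ Fintype.card K) * hw1 - this

end FieldBasics

/-! ### Ebert's condition and anisotropy -/

section Ebert

variable {K F : Type*} [Field K] [Fintype K] [Field F] [Algebra K F]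

variable (K) in
/-- The quadratic form `x ↦ a x² + b x^{q+1} mod K` on the `K`-space `F`, with values in the
one-dimensional space `F / K`, has no nontrivial zero. -/
def Anisotropic (a b : F) : Prop :=
  ∀ x : F, x ≠ 0 → a * x ^ 2 + b * x ^ (Fintype.card K + 1) ∉ Set.range (algebraMap K F)

lemma anisotropic_iff (hF : Module.finrank K F = 2) (a b : F) :
    Anisotropic K a b ↔
      ∀ k : K, (algebraMap K F k - b) ^ (Fintype.card K + 1) ≠ a ^ (Fintype.card K + 1) := by
  constructor
  · intro h k hk
    rcases eq_or_ne a 0 with rfl | ha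
    · have hb : b = algebraMap K F k := by
        rw [zero_pow (Nat.succ_ne_zero _)] at hk
        have := pow_eq_zero_iff (Nat.succ_ne_zero _) |>.1 hk
        linear_combination -this
      exact h 1 one_ne_zero ⟨k, by simp [hb]⟩
    · -- `(k - b) / a` has norm `1`, hence equals `x / x ^ q` for some `x`.
      obtain ⟨x, hx, hxw⟩ := exists_mul_pow_card_eq (K := K) hF
        (w := (algebraMap K F k - b) / a) (by rw [div_pow, hk, div_self (pow_ne_zero _ ha)])
      obtain ⟨n, hn⟩ := exists_norm (K := K) hF x
      refine h x hx ⟨k * n, ?_⟩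
      rw [map_mul, hn, pow_succ]
      rw [div_mul_eq_mul_div, div_eq_iff ha] at hxw
      linear_combination x * hxw
  · rintro h x hx ⟨m, hm⟩
    obtain ⟨n, hn⟩ := exists_norm (K := K) hF x
    have hxq : x ^ Fintype.card K ≠ 0 := pow_ne_zero _ hx
    have hn0 : algebraMap K F n ≠ 0 := hn ▸ pow_ne_zero _ hx
    apply h (m / n)
    have : algebraMap K F (m / n) - b = a * x / x ^ Fintype.card K := by
      rw [map_div₀, hm, hn, pow_succ]
      field_simp
      ring
    rw [this, div_pow, mul_pow, div_eq_iff (pow_ne_zero _ hxq)]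
    congr 1
    simp only [pow_succ _ (Fintype.card K), pow_card_pow_card hF]
    ring

/-- The Artin–Schreier criterion over a finite field of characteristic two. -/
lemma exists_sq_add_eq_iff_trace (L : Type*) [Field L] [Fintype L] [CharP L 2]
    [Algebra (ZMod 2) L] (c : L) :
    (∃ z, z ^ 2 + z = c) ↔ Algebra.trace (ZMod 2) L c = 0 := by
  let fr : L ≃ₐ[ZMod 2] L := FiniteField.frobeniusAlgEquivOfAlgebraic (ZMod 2) L
  have hfr : ∀ z, fr z = z ^ 2 := fun z => by
    simp [fr]
  let A : L →ₗ[ZMod 2] L := fr.toLinearMap + LinearMap.id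
  have hA : ∀ z, A z = z ^ 2 + z := fun z => by simp [A, hfr]
  let T : L →ₗ[ZMod 2] ZMod 2 := Algebra.trace (ZMod 2) L
  have hle : LinearMap.range A ≤ LinearMap.ker T := by
    rintro _ ⟨z, rfl⟩
    rw [LinearMap.mem_ker, hA, map_add, ← hfr]
    have : T (fr z) = T z := Algebra.trace_eq_of_algEquiv fr z
    rw [this, CharTwo.add_self_eq_zero]
  have hker : LinearMap.ker A = Submodule.span (ZMod 2) {(1 : L)} := by
    ext z
    rw [LinearMap.mem_ker, hA, Submodule.mem_span_singleton]
    constructor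
    · intro h
      have h' : z * (z + 1) = 0 := by linear_combination h
      rcases mul_eq_zero.1 h' with h0 | h1
      · exact ⟨0, by simp [h0]⟩
      · exact ⟨1, by rw [one_smul]; exact (CharTwo.add_eq_zero.1 h1).symm⟩
    · rintro ⟨t, rfl⟩
      have ht : ∀ t : ZMod 2, t = 0 ∨ t = 1 := by decide
      rcases ht t with rfl | rfl <;> simp [CharTwo.add_self_eq_zero]
  have h1 := LinearMap.finrank_range_add_finrank_ker A
  have h2 := LinearMap.finrank_range_add_finrank_ker T
  have hT : LinearMap.range T = ⊤ := LinearMap.range_eq_top.2 (Algebra.trace_surjective _ _)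
  rw [hker, finrank_span_singleton one_ne_zero] at h1
  rw [hT, finrank_top, Module.finrank_self] at h2
  have heq := Submodule.eq_of_le_of_finrank_eq hle (by omega)
  have : c ∈ LinearMap.range A ↔ c ∈ LinearMap.ker T := by rw [heq]
  simpa [LinearMap.mem_range, hA, T] using this

lemma anisotropic_iff_no_root (hF : Module.finrank K F = 2) {a b : F} {t n m : K}
    (ht : algebraMap K F t = b ^ Fintype.card K + b)
    (hn : algebraMap K F n = b ^ (Fintype.card K + 1))
    (hm : algebraMap K F m = a ^ (Fintype.card K + 1)) :
    Anisotropic K a b ↔ ∀ k : K, k ^ 2 - t * k + (n - m) ≠ 0 := by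
  rw [anisotropic_iff hF]
  refine forall_congr' fun k => not_congr ?_
  rw [← hm, ← (algebraMap K F).injective.eq_iff, map_zero, pow_succ, pow_card_sub,
    pow_card_algebraMap]
  simp only [map_add, map_sub, map_mul, map_pow, ht, hn, pow_succ b]
  constructor <;> intro h <;> linear_combination h

lemma anisotropic_zero_left_iff (hF : Module.finrank K F = 2) (b : F) :
    Anisotropic K 0 b ↔ b ∉ Set.range (algebraMap K F) := by
  rw [anisotropic_iff hF]
  simp only [zero_pow (Nat.succ_ne_zero _), ne_eq, pow_eq_zero_iff (Nat.succ_ne_zero _),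
    sub_eq_zero, Set.mem_range, not_exists]

lemma ebertCondition_iff_of_odd (hF : Module.finrank K F = 2) (hq : Odd (Fintype.card K))
    (a b : F) : EbertCondition K a b ↔ Anisotropic K a b := by
  obtain ⟨t, ht⟩ := exists_trace (K := K) hF b
  obtain ⟨n, hn⟩ := exists_norm (K := K) hF b
  obtain ⟨m, hm⟩ := exists_norm (K := K) hF a
  have hchar : ringChar K ≠ 2 := fun h => by
    have := FiniteField.even_card_iff_char_two.1 h
    exact (Nat.not_even_iff_odd.2 hq) (Nat.even_iff.2 this)
  have h2 : (2 : K) ≠ 0 := Ring.two_ne_zero hchar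
  have : NeZero (2 : K) := ⟨h2⟩
  have hd : algebraMap K F (discrim 1 (-t) (n - m))
      = 4 * a ^ (Fintype.card K + 1) + (b ^ Fintype.card K - b) ^ 2 := by
    simp only [discrim, map_sub, map_pow, map_mul, map_neg, map_one, map_ofNat, ht, hn, hm,
      pow_succ b]
    ring
  have h1 : EbertCondition K a b ↔ ¬ IsSquare (discrim 1 (-t) (n - m)) := by
    simp only [EbertCondition, hq, Nat.not_even_iff_odd.2 hq, true_implies, false_implies,
      and_true]
    constructor
    · rintro ⟨d, hd', hs⟩
      rwa [(algebraMap K F).injective (hd.trans hd'.symm)]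
    · exact fun h => ⟨_, hd, h⟩
  rw [h1, anisotropic_iff_no_root hF ht hn hm, ← not_exists_not, not_iff_not]
  simp only [not_not]
  constructor
  · rintro ⟨s, hs⟩
    obtain ⟨x, hx⟩ := exists_quadratic_eq_zero (a := (1 : K)) one_ne_zero ⟨s, hs⟩
    exact ⟨x, by linear_combination hx⟩
  · rintro ⟨k, hk⟩
    exact ⟨2 * k - t, by rw [discrim]; linear_combination (-4) * hk⟩

lemma ebertCondition_iff_of_even (hF : Module.finrank K F = 2) (hq : Even (Fintype.card K))
    (a b : F) : EbertCondition K a b ↔ Anisotropic K a b := by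
  obtain ⟨t, ht⟩ := exists_trace (K := K) hF b
  obtain ⟨n, hn⟩ := exists_norm (K := K) hF b
  obtain ⟨m, hm⟩ := exists_norm (K := K) hF a
  have hchar : ringChar K = 2 := FiniteField.even_card_iff_char_two.2 (Nat.even_iff.1 hq)
  have hK2 : CharP K 2 := ringChar.of_eq hchar
  have hF2 : CharP F 2 := charP_of_injective_algebraMap (algebraMap K F).injective 2
  let := ZMod.algebra K 2
  have hb : b ∈ Set.range (algebraMap K F) ↔ t = 0 := by
    rw [mem_range_iff, ← (algebraMap K F).injective.eq_iff, ht, map_zero, CharTwo.add_eq_zero]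
  -- `X² + tX + c` with `t ≠ 0` has a root if and only if `c / t²` has trace zero.
  have hroot : t ≠ 0 → ∀ c : K, (∃ k, k ^ 2 - t * k + c = 0) ↔
      Algebra.trace (ZMod 2) K (c / t ^ 2) = 0 := by
    intro ht0 c
    rw [← exists_sq_add_eq_iff_trace]
    constructor
    · rintro ⟨k, hk⟩
      refine ⟨k / t, ?_⟩
      rw [CharTwo.sub_eq_add, CharTwo.add_eq_zero] at hk
      rw [← hk]
      field_simp
    · rintro ⟨z, hz⟩
      refine ⟨t * z, ?_⟩
      rw [CharTwo.sub_eq_add, CharTwo.add_eq_zero]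
      rw [eq_div_iff (pow_ne_zero _ ht0)] at hz
      rw [← hz]
      ring
  -- The roots of `X² + tX + n` are `b` and `b ^ q`.
  have htn : t ≠ 0 → Algebra.trace (ZMod 2) K (n / t ^ 2) = 1 := by
    intro ht0
    have h01 : ∀ z : ZMod 2, z ≠ 0 → z = 1 := by decide
    apply h01
    rw [ne_eq, ← hroot ht0]
    rintro ⟨k, hk⟩
    have hb0 : Anisotropic K 0 b := (anisotropic_zero_left_iff hF b).2 (mt hb.1 ht0)
    rw [anisotropic_iff_no_root hF (m := 0) ht hn
      (by rw [map_zero, zero_pow (Nat.succ_ne_zero _)])] at hb0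
    exact hb0 k (by rw [sub_zero]; exact hk)
  have hE : EbertCondition K a b ↔ t ≠ 0 ∧ Algebra.trace (ZMod 2) K (m / t ^ 2) = 0 := by
    have hd : algebraMap K F (m / t ^ 2)
        = a ^ (Fintype.card K + 1) / (b ^ Fintype.card K + b) ^ 2 := by
      rw [map_div₀, map_pow, hm, ht]
    simp only [EbertCondition, hq, Nat.not_odd_iff_even.2 hq, true_implies, false_implies,
      true_and, hb]
    refine and_congr_right fun _ => ⟨?_, ?_⟩
    · rintro ⟨d, hd', _, hs⟩
      rwa [(algebraMap K F).injective (hd.trans hd'.symm)]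
    · exact fun h => ⟨_, hd, hK2, h⟩
  rw [hE, anisotropic_iff_no_root hF ht hn hm]
  rcases eq_or_ne t 0 with rfl | ht0
  · simp only [ne_eq, not_true_eq_false, false_and, false_iff, not_forall, not_not]
    obtain ⟨s, hs⟩ := FiniteField.isSquare_of_char_two hchar (n - m)
    exact ⟨s, by rw [hs, zero_mul, sub_zero, sq, CharTwo.add_self_eq_zero]⟩
  · have := hroot ht0 (n - m)
    rw [← not_exists, this, sub_div, map_sub, htn ht0]
    generalize Algebra.trace (ZMod 2) K (m / t ^ 2) = z
    revert z
    simp only [ne_eq, ht0, not_false_eq_true, true_and]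
    decide

/-- Ebert's discriminant condition says that `x ↦ a x² + b x^{q+1}` is anisotropic modulo `K`. -/
theorem ebertCondition_iff (hF : Module.finrank K F = 2) (a b : F) :
    EbertCondition K a b ↔ Anisotropic K a b := by
  rcases Nat.even_or_odd (Fintype.card K) with hq | hq
  · exact ebertCondition_iff_of_even hF hq a b
  · exact ebertCondition_iff_of_odd hF hq a b

lemma Anisotropic.neg_left (hF : Module.finrank K F = 2) {a b : F} (h : Anisotropic K a b) :
    Anisotropic K (-a) b := by
  rw [anisotropic_iff hF] at h ⊢
  simpa only [pow_succ (-a), pow_succ a, pow_card_neg, neg_mul_neg] using h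

/-- For `q = 2` there is no anisotropic pair with `a ≠ 0` and `b ∉ K`. -/
lemma Anisotropic.two_lt_card (hF : Module.finrank K F = 2) {a b : F} (h : Anisotropic K a b)
    (ha : a ≠ 0) (hb : b ∉ Set.range (algebraMap K F)) : 2 < Fintype.card K := by
  by_contra hq
  have hq2 : Fintype.card K = 2 := le_antisymm (not_lt.1 hq) Fintype.one_lt_card
  have := finite_of_finrank_eq_two hF
  have := Fintype.ofFinite F
  have hcard : Fintype.card F = 4 := by rw [card_eq_sq hF, hq2]; rfl
  have h3 : ∀ x : F, x ≠ 0 → x ^ 3 = 1 := fun x hx => by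
    simpa [hcard] using FiniteField.pow_card_sub_one_eq_one x hx
  rw [anisotropic_iff hF, hq2] at h
  refine h 0 ?_
  have hb0 : b ≠ 0 := fun h => hb ⟨0, by simp [h]⟩
  rw [h3 a ha, map_zero, zero_sub, h3 _ (neg_ne_zero.2 hb0)]

end Ebert

/-! ### Zeros of an anisotropic quadratic polynomial on a plane over a finite field -/

section Counting

variable {K E : Type*} [Field K] [Fintype K] [AddCommGroup E] [Module K E]

/-- A conic of the projective plane over `K` with no point at infinity has an affine point: it
has some point by the Chevalley–Warning theorem. -/
lemma exists_zero (hE : Module.finrank K E = 2) (N : QuadraticForm K E)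
    (hN : ∀ x, N x = 0 → x = 0) (μ : E →ₗ[K] K) (δ : K) : ∃ x, N x + μ x + δ = 0 := by
  classical
  have : Module.Finite K E := Module.finite_of_finrank_pos (by omega)
  let B := Module.finBasisOfFinrankEq K E hE
  let f : MvPolynomial (Fin 3) K :=
    .C (N (B 0)) * (.X 0 * .X 0) + .C (N (B 1)) * (.X 1 * .X 1)
      + .C (QuadraticMap.polar N (B 0) (B 1)) * (.X 0 * .X 1)
      + .C (μ (B 0)) * (.X 0 * .X 2) + .C (μ (B 1)) * (.X 1 * .X 2) + .C δ * (.X 2 * .X 2)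
  have hmon : ∀ (c : K) (i j : Fin 3),
      (MvPolynomial.C c * (.X i * .X j) : MvPolynomial (Fin 3) K).IsHomogeneous 2 := by
    intro c i j
    have := (MvPolynomial.isHomogeneous_C (Fin 3) c).mul
      ((MvPolynomial.isHomogeneous_X K i).mul (MvPolynomial.isHomogeneous_X K j))
    simpa using this
  have hf : f.IsHomogeneous 2 :=
    (((((hmon _ _ _).add (hmon _ _ _)).add (hmon _ _ _)).add (hmon _ _ _)).add
      (hmon _ _ _)).add (hmon _ _ _)
  have heval : ∀ v : Fin 3 → K, MvPolynomial.eval v f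
      = N (v 0 • B 0 + v 1 • B 1) + v 2 * μ (v 0 • B 0 + v 1 • B 1) + δ * v 2 ^ 2 := by
    intro v
    rw [QuadraticMap.map_add N]
    simp only [f, map_add, map_mul, MvPolynomial.eval_C, MvPolynomial.eval_X,
      QuadraticMap.map_smul, map_smul, QuadraticMap.polar_smul_left,
      QuadraticMap.polar_smul_right, smul_eq_mul]
    ring
  have hcw := char_dvd_card_solutions (ringChar K) (f := f)
    (lt_of_le_of_lt hf.totalDegree_le (by simp))
  have hchar : 1 < ringChar K := (CharP.char_is_prime K (ringChar K)).one_lt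
  have h0 : MvPolynomial.eval (0 : Fin 3 → K) f = 0 := by rw [heval]; simp
  have hpos : 0 < Fintype.card {v : Fin 3 → K // MvPolynomial.eval v f = 0} :=
    Fintype.card_pos_iff.2 ⟨⟨0, h0⟩⟩
  obtain ⟨⟨v, hv⟩, hne⟩ := Fintype.exists_ne_of_one_lt_card
    (hchar.trans_le (Nat.le_of_dvd hpos hcw)) ⟨0, h0⟩
  have hv0 : v ≠ 0 := fun h => hne (Subtype.ext h)
  rw [heval] at hv
  set x := v 0 • B 0 + v 1 • B 1 with hx
  have hz : v 2 ≠ 0 := by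
    intro hz
    have hx0 : x = 0 := hN _ (by simpa [hz] using hv)
    have hli := LinearIndependent.pair_iff.1
      ((LinearIndependent.pair_iff (x := B 0) (y := B 1)).2 fun s t hst => by
        have := Fintype.linearIndependent_iff.1 B.linearIndependent ![s, t]
          (by simpa [Fin.sum_univ_two] using hst)
        exact ⟨this 0, this 1⟩) (v 0) (v 1) hx0
    exact hv0 (by ext i; fin_cases i <;> simp [hli.1, hli.2, hz])
  refine ⟨(v 2)⁻¹ • x, ?_⟩
  rw [QuadraticMap.map_smul, map_smul, smul_eq_mul, smul_eq_mul]
  field_simp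
  linear_combination hv

lemma ncard_linearMap_fiber (hE : Module.finrank K E = 2) (μ : E →ₗ[K] K) (hμ : μ ≠ 0) (c : K) :
    {x | μ x = c}.ncard = Fintype.card K := by
  have : Module.Finite K E := Module.finite_of_finrank_pos (by omega)
  have hsurj := LinearMap.surjective hμ
  obtain ⟨x₀, hx₀⟩ := hsurj c
  have h1 : {x | μ x = c} = (fun x => x₀ + x) '' (LinearMap.ker μ : Set E) := by
    ext x
    simp only [Set.mem_ofPred_eq, Set.mem_image, SetLike.mem_coe, LinearMap.mem_ker]
    constructor
    · intro h
      exact ⟨x - x₀, by rw [map_sub, h, hx₀, sub_self], by abel⟩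
    · rintro ⟨y, hy, rfl⟩
      rw [map_add, hy, hx₀, add_zero]
  have h2 := LinearMap.finrank_range_add_finrank_ker μ
  rw [LinearMap.range_eq_top.2 hsurj, finrank_top, Module.finrank_self, hE] at h2
  rw [h1, Set.ncard_image_of_injective _ (add_right_injective x₀)]
  change Nat.card (LinearMap.ker μ) = _
  have : Fintype (LinearMap.ker μ) := by
    have := Module.finite_of_finite K (M := LinearMap.ker μ)
    exact Fintype.ofFinite _
  rw [Nat.card_eq_fintype_card, Module.card_eq_pow_finrank (K := K),
    show Module.finrank K (LinearMap.ker μ) = 1 by omega, pow_one]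

/-- With `N` anisotropic, the zeros of `N + μ` other than the origin are in bijection with the
points of the affine line `μ = -1`, by the inversion `x ↦ x / N x`. -/
lemma ncard_zeros_of_zero (hE : Module.finrank K E = 2) (N : QuadraticForm K E)
    (hN : ∀ x, N x = 0 → x = 0) (μ : E →ₗ[K] K) :
    {x | N x + μ x = 0}.ncard = 1 ∨ {x | N x + μ x = 0}.ncard = Fintype.card K + 1 := by
  rcases eq_or_ne μ 0 with rfl | hμ
  · left
    rw [Set.ncard_eq_one]
    refine ⟨0, Set.ext fun x => ⟨fun h => hN x (by simpa using h), ?_⟩⟩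
    rintro rfl
    simp
  · right
    have : Module.Finite K E := Module.finite_of_finrank_pos (by omega)
    have := Module.finite_of_finite K (M := E)
    have hN' : ∀ x, x ≠ 0 → N x ≠ 0 := fun x hx h => hx (hN x h)
    have h0 : ∀ w : E, μ w = -1 → w ≠ 0 := by
      rintro _ hw rfl
      simp at hw
    have hinv : ∀ w : E, w ≠ 0 → N ((N w)⁻¹ • w) = (N w)⁻¹ := fun w hw => by
      rw [QuadraticMap.map_smul, smul_eq_mul, mul_assoc, inv_mul_cancel₀ (hN' w hw), mul_one]
    have hset : {x | N x + μ x = 0}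
        = insert 0 ((fun w => (N w)⁻¹ • w) '' {w | μ w = -1}) := by
      ext x
      simp only [Set.mem_ofPred_eq, Set.mem_insert_iff, Set.mem_image]
      constructor
      · intro hx
        rw [or_iff_not_imp_left]
        intro hx0
        refine ⟨(N x)⁻¹ • x, ?_, ?_⟩
        · rw [map_smul, smul_eq_mul, inv_mul_eq_iff_eq_mul₀ (hN' x hx0)]
          linear_combination hx
        · rw [hinv x hx0, inv_inv, smul_smul, mul_inv_cancel₀ (hN' x hx0), one_smul]
      · rintro (rfl | ⟨w, hw, rfl⟩)
        · simp
        · rw [hinv w (h0 w hw), map_smul, hw, smul_eq_mul]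
          ring
    rw [hset, Set.ncard_insert_of_notMem, Set.InjOn.ncard_image,
      ncard_linearMap_fiber hE μ hμ]
    · intro w hw w' hw' h
      have h' := congrArg N h
      simp only at h h'
      rw [hinv w (h0 w hw), hinv w' (h0 w' hw')] at h'
      rw [h'] at h
      exact smul_right_injective E (inv_ne_zero (hN' w' (h0 w' hw'))) h
    · rintro ⟨w, hw, hw'⟩
      exact h0 w hw ((smul_eq_zero.1 hw').resolve_left (inv_ne_zero (hN' w (h0 w hw))))

lemma ncard_zeros (hE : Module.finrank K E = 2) (N : QuadraticForm K E)
    (hN : ∀ x, N x = 0 → x = 0) (μ : E →ₗ[K] K) (δ : K) :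
    {x | N x + μ x + δ = 0}.ncard = 1 ∨ {x | N x + μ x + δ = 0}.ncard = Fintype.card K + 1 := by
  obtain ⟨x₀, hx₀⟩ := exists_zero hE N hN μ δ
  have h1 : {x | N x + μ x + δ = 0}
      = (fun x => x₀ + x) '' {x | N x + (μ + N.polarBilin x₀) x = 0} := by
    ext x
    simp only [Set.mem_ofPred_eq, Set.mem_image]
    constructor
    · intro h
      refine ⟨x - x₀, ?_, by abel⟩
      have h2 := QuadraticMap.map_add N x₀ (x - x₀)
      rw [add_sub_cancel] at h2
      rw [LinearMap.add_apply, QuadraticMap.polarBilin_apply_apply, map_sub μ]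
      linear_combination h - hx₀ - h2
    · rintro ⟨y, hy, rfl⟩
      rw [LinearMap.add_apply, QuadraticMap.polarBilin_apply_apply] at hy
      rw [QuadraticMap.map_add N, map_add]
      linear_combination hy + hx₀
  rw [h1, Set.ncard_image_of_injective _ (add_right_injective x₀)]
  exact ncard_zeros_of_zero hE N hN _

end Counting

section AnisotropicForm

variable {K F : Type*} [Field K] [Fintype K] [Field F] [Algebra K F]

/-- The quadratic form `x ↦ φ (a x² + b x^{q+1})` on the `K`-space `F`. -/
noncomputable def quadForm (φ : F →ₗ[K] K) (a b : F) : QuadraticForm K F :=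
  φ.compQuadraticMap
    (QuadraticMap.linMulLin (LinearMap.mulLeft K a) LinearMap.id +
      QuadraticMap.linMulLin
        (LinearMap.mulLeft K b ∘ₗ (FiniteField.frobeniusAlgHom K F).toLinearMap) LinearMap.id)

lemma quadForm_apply (φ : F →ₗ[K] K) (a b x : F) :
    quadForm φ a b x = φ (a * x ^ 2 + b * x ^ (Fintype.card K + 1)) := by
  simp [quadForm, pow_succ, mul_assoc]

lemma Anisotropic.eq_zero_of_quadForm {a b : F} (h : Anisotropic K a b) {e : F} {φ : F →ₗ[K] K}
    (hk : ∀ k, φ (algebraMap K F k) = 0) (hy : ∀ y, ∃ k, y = algebraMap K F k + φ y • e)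
    (x : F) (hx : quadForm φ a b x = 0) : x = 0 := by
  by_contra h0
  exact h x h0 ((mem_range_iff_coord hk hy _).2 (by rwa [quadForm_apply] at hx))

/-- The number of points of `U_{a,b}` on a line not through `Y_∞`. -/
lemma Anisotropic.ncard_eq (hF : Module.finrank K F = 2) {a b : F} (h : Anisotropic K a b)
    (m d : F) :
    {x : F | a * x ^ 2 + b * x ^ (Fintype.card K + 1) + m * x + d
      ∈ Set.range (algebraMap K F)}.ncard = 1 ∨
    {x : F | a * x ^ 2 + b * x ^ (Fintype.card K + 1) + m * x + d
      ∈ Set.range (algebraMap K F)}.ncard = Fintype.card K + 1 := by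
  obtain ⟨e, φ, -, hk, hy⟩ := exists_coord hF
  have := ncard_zeros hF (quadForm φ a b) (h.eq_zero_of_quadForm hk hy)
    (φ ∘ₗ LinearMap.mulLeft K m) (φ d)
  simpa only [mem_range_iff_coord hk hy, map_add, quadForm_apply, LinearMap.comp_apply,
    LinearMap.mulLeft_apply] using this

end AnisotropicForm

/-! ### Points and lines of the projective plane -/

section Plane

variable {F : Type*} [Field F]

/-- The infinite point `(0, 1, m)` of the lines of slope `m`. -/
def slopePt (m : F) : PG2 F :=
  Projectivization.mk F ![0, 1, m] (fun h => one_ne_zero (congrFun h 1))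

lemma affPt_inj {x y x' y' : F} : affPt x y = affPt x' y' ↔ x = x' ∧ y = y' := by
  refine ⟨fun h => ?_, fun h => by rw [h.1, h.2]⟩
  obtain ⟨c, hc⟩ := (Projectivization.mk_eq_mk_iff' _ _ _ _ _).1 h
  have h0 := congrFun hc 0
  have h1 := congrFun hc 1
  have h2 := congrFun hc 2
  simp at h0 h1 h2
  subst h0
  simp at h1 h2
  exact ⟨h1.symm, h2.symm⟩

lemma slopePt_inj {m m' : F} : slopePt m = slopePt m' ↔ m = m' := by
  refine ⟨fun h => ?_, fun h => by rw [h]⟩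
  obtain ⟨c, hc⟩ := (Projectivization.mk_eq_mk_iff' _ _ _ _ _).1 h
  have h1 := congrFun hc 1
  have h2 := congrFun hc 2
  simp at h1 h2
  subst h1
  simpa using h2.symm

lemma affPt_ne_slopePt (x y m : F) : affPt x y ≠ slopePt m := by
  intro h
  obtain ⟨c, hc⟩ := (Projectivization.mk_eq_mk_iff' _ _ _ _ _).1 h
  simpa using congrFun hc 0

lemma affPt_ne_yInf (x y : F) : affPt x y ≠ yInf F := by
  intro h
  obtain ⟨c, hc⟩ := (Projectivization.mk_eq_mk_iff' _ _ _ _ _).1 h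
  simpa using congrFun hc 0

lemma slopePt_ne_yInf (m : F) : slopePt m ≠ yInf F := by
  intro h
  obtain ⟨c, hc⟩ := (Projectivization.mk_eq_mk_iff' _ _ _ _ _).1 h
  simpa using congrFun hc 1

lemma mk_eq_affPt {v : Fin 3 → F} (hv : v ≠ 0) (h : v 0 ≠ 0) :
    Projectivization.mk F v hv = affPt (v 1 / v 0) (v 2 / v 0) := by
  refine (Projectivization.mk_eq_mk_iff' _ _ _ _ _).2 ⟨v 0, ?_⟩
  ext i
  fin_cases i <;> simp [mul_div_cancel₀, h]

lemma mk_eq_slopePt {v : Fin 3 → F} (hv : v ≠ 0) (h : v 0 = 0) (h1 : v 1 ≠ 0) :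
    Projectivization.mk F v hv = slopePt (v 2 / v 1) := by
  refine (Projectivization.mk_eq_mk_iff' _ _ _ _ _).2 ⟨v 1, ?_⟩
  ext i
  fin_cases i <;> simp [mul_div_cancel₀, h, h1]

lemma mk_eq_yInf {v : Fin 3 → F} (hv : v ≠ 0) (h : v 0 = 0) (h1 : v 1 = 0) :
    Projectivization.mk F v hv = yInf F := by
  refine (Projectivization.mk_eq_mk_iff' _ _ _ _ _).2 ⟨v 2, ?_⟩
  ext i
  fin_cases i <;> simp [h, h1]

lemma pg2_cases (p : PG2 F) :
    (∃ x y, p = affPt x y) ∨ (∃ m, p = slopePt m) ∨ p = yInf F := by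
  induction p using Projectivization.ind with
  | h v hv =>
    by_cases h : v 0 = 0
    · by_cases h1 : v 1 = 0
      · exact Or.inr (Or.inr (mk_eq_yInf hv h h1))
      · exact Or.inr (Or.inl ⟨_, mk_eq_slopePt hv h h1⟩)
    · exact Or.inl ⟨_, _, mk_eq_affPt hv h⟩

/-- A property of vectors which is invariant under nonzero scalars may be tested on any
representative of a point. -/
lemma rep_iff {L M : Type*} [Field L] [AddCommGroup M] [Module L M] {P : M → Prop}
    (hP : ∀ (c : L) v, c ≠ 0 → P v → P (c • v)) {v : M} (hv : v ≠ 0) :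
    P (Projectivization.mk L v hv).rep ↔ P v := by
  obtain ⟨c, hc⟩ := Projectivization.exists_smul_eq_mk_rep L v hv
  rw [← hc]
  constructor
  · intro h
    have := hP (c⁻¹ : Lˣ) _ (Units.ne_zero _) h
    rwa [← Units.smul_def, inv_smul_smul] at this
  · exact hP c v c.ne_zero

/-- The line `c₀x₀ + c₁x₁ + c₂x₂ = 0`. -/
def lineSet (c : Fin 3 → F) : Set (PG2 F) := {p | c ⬝ᵥ p.rep = 0}

lemma mk_mem_lineSet {c v : Fin 3 → F} (hv : v ≠ 0) :
    Projectivization.mk F v hv ∈ lineSet c ↔ c ⬝ᵥ v = 0 :=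
  rep_iff (P := fun v => c ⬝ᵥ v = 0) (fun k v _ h => by
    change c ⬝ᵥ v = 0 at h
    rw [dotProduct_smul, h, smul_zero]) hv

lemma affPt_mem_lineSet {c : Fin 3 → F} {x y : F} :
    affPt x y ∈ lineSet c ↔ c 0 + c 1 * x + c 2 * y = 0 := by
  rw [affPt, mk_mem_lineSet]
  simp [dotProduct, Fin.sum_univ_three]

lemma slopePt_mem_lineSet {c : Fin 3 → F} {m : F} :
    slopePt m ∈ lineSet c ↔ c 1 + c 2 * m = 0 := by
  rw [slopePt, mk_mem_lineSet]
  simp [dotProduct, Fin.sum_univ_three]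

lemma yInf_mem_lineSet {c : Fin 3 → F} : yInf F ∈ lineSet c ↔ c 2 = 0 := by
  rw [yInf, mk_mem_lineSet]
  simp [dotProduct, Fin.sum_univ_three]

end Plane

/-! ### The coordinatization of the projective closure of `𝔄_a` -/

section Closure

variable {F : Type*} [Field F] (a : F)

lemma parabola_inj {m d m' d' : F} :
    parabola a m d = parabola a m' d' ↔ m = m' ∧ d = d' := by
  refine ⟨fun h => ?_, fun h => by rw [h.1, h.2]⟩
  have key : ∀ x : F, a * x ^ 2 + m * x + d = a * x ^ 2 + m' * x + d' := fun x => by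
    have : ((x, a * x ^ 2 + m * x + d) : F × F) ∈ parabola a m' d' := h ▸ rfl
    exact this
  have h0 := key 0
  have h1 := key 1
  have hd : d = d' := by linear_combination h0
  exact ⟨by linear_combination h1 - hd, hd⟩

lemma verticalLine_ne_parabola (k m d : F) : verticalLine k ≠ parabola a m d := by
  intro h
  have h0 : ((k, a * k ^ 2 + m * k + d + 1) : F × F) ∈ parabola a m d := h ▸ rfl
  simp [parabola] at h0

lemma verticalLine_mem (k : F) : verticalLine k ∈ parabolaPlane a := Or.inl ⟨k, rfl⟩

lemma parabola_mem (m d : F) : parabola a m d ∈ parabolaPlane a := Or.inr ⟨m, d, rfl⟩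

lemma not_disjoint_verticalLine_parabola (k m d : F) :
    ¬ Disjoint (verticalLine k) (parabola a m d) := by
  rw [Set.not_disjoint_iff]
  exact ⟨(k, a * k ^ 2 + m * k + d), rfl, rfl⟩

lemma verticalLine_mem_parallelClass {k k' : F} :
    verticalLine k' ∈ parallelClass (parabolaPlane a) (verticalLine k) := by
  refine ⟨verticalLine_mem a k', ?_⟩
  rcases eq_or_ne k' k with rfl | h
  · exact Or.inl rfl
  · refine Or.inr (Set.disjoint_left.2 fun p hp hp' => h ?_)
    exact (show p.1 = k' from hp).symm.trans hp'

lemma parabola_notMem_parallelClass (k m d : F) :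
    parabola a m d ∉ parallelClass (parabolaPlane a) (verticalLine k) := by
  rintro ⟨-, h | h⟩
  · exact verticalLine_ne_parabola a k m d h.symm
  · exact not_disjoint_verticalLine_parabola a k m d h.symm

lemma verticalLine_notMem_parallelClass (k m d : F) :
    verticalLine k ∉ parallelClass (parabolaPlane a) (parabola a m d) := by
  rintro ⟨-, h | h⟩
  · exact verticalLine_ne_parabola a k m d h
  · exact not_disjoint_verticalLine_parabola a k m d h

lemma parabola_mem_parallelClass {m d m' d' : F} :
    parabola a m' d' ∈ parallelClass (parabolaPlane a) (parabola a m d) ↔ m' = m := by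
  constructor
  · rintro ⟨-, h | h⟩
    · exact ((parabola_inj a).1 h).1
    · by_contra hm
      -- Parabolas with distinct slopes `m'`, `m` meet over the point `x = (d - d') / (m' - m)`.
      have hm' : m' - m ≠ 0 := sub_ne_zero.2 hm
      have hp : ((d - d') / (m' - m),
          a * ((d - d') / (m' - m)) ^ 2 + m' * ((d - d') / (m' - m)) + d')
            ∈ parabola a m' d' := rfl
      refine Set.disjoint_left.1 h hp ?_
      simp only [parabola, Set.mem_ofPred_eq]
      field_simp
      ring
  · rintro rfl
    refine ⟨parabola_mem a m' d', ?_⟩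
    rcases eq_or_ne d' d with rfl | h
    · exact Or.inl rfl
    · refine Or.inr (Set.disjoint_left.2 fun p hp hp' => h ?_)
      have := (show p.2 = _ from hp).symm.trans hp'
      linear_combination this

/-- The points at infinity of the closure of `𝔄_a`: one for each slope `m`, and the infinite
point of the vertical lines for `none`. -/
def infPt : Option F → {C : Set (Set (F × F)) //
    ∃ l ∈ parabolaPlane a, C = parallelClass (parabolaPlane a) l}
  | none => ⟨parallelClass (parabolaPlane a) (verticalLine 0),
      verticalLine 0, Or.inl ⟨0, rfl⟩, rfl⟩
  | some m => ⟨parallelClass (parabolaPlane a) (parabola a m 0),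
      parabola a m 0, parabola_mem a m 0, rfl⟩

lemma verticalLine_mem_infPt_none (k : F) : verticalLine k ∈ (infPt a none).1 :=
  verticalLine_mem_parallelClass a

lemma verticalLine_notMem_infPt_some (k m : F) : verticalLine k ∉ (infPt a (some m)).1 :=
  verticalLine_notMem_parallelClass a k m 0

lemma parabola_notMem_infPt_none (m d : F) : parabola a m d ∉ (infPt a none).1 :=
  parabola_notMem_parallelClass a 0 m d

lemma parabola_mem_infPt_some {m d m' : F} :
    parabola a m d ∈ (infPt a (some m')).1 ↔ m = m' :=
  parabola_mem_parallelClass a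

lemma infPt_bijective : Function.Bijective (infPt a) := by
  constructor
  · rintro (_ | m) (_ | m') h
    · rfl
    · exact absurd (h ▸ verticalLine_mem_infPt_none a 0) (verticalLine_notMem_infPt_some a 0 m')
    · exact absurd (h.symm ▸ verticalLine_mem_infPt_none a 0)
        (verticalLine_notMem_infPt_some a 0 m)
    · have h1 : parabola a m 0 ∈ (infPt a (some m')).1 :=
        h ▸ (parabola_mem_infPt_some a).2 rfl
      rw [(parabola_mem_infPt_some a).1 h1]
  · rintro ⟨C, l, hl, rfl⟩
    rcases hl with ⟨k, rfl⟩ | ⟨m, d, rfl⟩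
    · refine ⟨none, Subtype.ext (Set.ext fun l => ?_)⟩
      by_cases hl : l ∈ parabolaPlane a
      · rcases hl with ⟨k, rfl⟩ | ⟨m, d, rfl⟩
        · exact iff_of_true (verticalLine_mem_infPt_none a _) (verticalLine_mem_parallelClass a)
        · exact iff_of_false (parabola_notMem_infPt_none a m d)
            (parabola_notMem_parallelClass a _ _ _)
      · exact iff_of_false (fun h => hl h.1) (fun h => hl h.1)
    · refine ⟨some m, Subtype.ext (Set.ext fun l => ?_)⟩
      by_cases hl : l ∈ parabolaPlane a
      · rcases hl with ⟨k, rfl⟩ | ⟨m, d, rfl⟩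
        · exact iff_of_false (verticalLine_notMem_infPt_some a _ _)
            (verticalLine_notMem_parallelClass a _ _ _)
        · exact (parabola_mem_infPt_some a).trans (parabola_mem_parallelClass a).symm
      · exact iff_of_false (fun h => hl h.1) (fun h => hl h.1)

/-- The points of `PG(2,F)` in terms of affine points and slopes. -/
def planePt : (F × F) ⊕ Option F → PG2 F
  | Sum.inl p => affPt p.1 p.2
  | Sum.inr none => yInf F
  | Sum.inr (some m) => slopePt m

lemma planePt_bijective : Function.Bijective (planePt (F := F)) := by
  constructor
  · rintro (⟨x, y⟩ | (_ | m)) (⟨x', y'⟩ | (_ | m')) h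
    · obtain ⟨rfl, rfl⟩ := affPt_inj.1 h
      rfl
    · exact absurd h (affPt_ne_yInf _ _)
    · exact absurd h (affPt_ne_slopePt _ _ _)
    · exact absurd h.symm (affPt_ne_yInf _ _)
    · rfl
    · exact absurd h.symm (slopePt_ne_yInf _)
    · exact absurd h.symm (affPt_ne_slopePt _ _ _)
    · exact absurd h (slopePt_ne_yInf _)
    · rw [slopePt_inj.1 h]
  · intro p
    rcases pg2_cases p with ⟨x, y, rfl⟩ | ⟨m, rfl⟩ | rfl
    · exact ⟨Sum.inl (x, y), rfl⟩
    · exact ⟨Sum.inr (some m), rfl⟩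
    · exact ⟨Sum.inr none, rfl⟩

/-- The identification of the closure of `𝔄_a` with `PG(2,F)` which maps `(x, y)` to
`(1, x, y - a x²)`. -/
noncomputable def coordinatization : ClosurePoint (parabolaPlane a) ≃ PG2 F :=
  (Equiv.sumCongr
    { toFun := fun p : F × F => (p.1, p.2 - a * p.1 ^ 2)
      invFun := fun p : F × F => (p.1, p.2 + a * p.1 ^ 2)
      left_inv := fun p => by simp
      right_inv := fun p => by simp }
    (Equiv.ofBijective (infPt a) (infPt_bijective a)).symm).trans
  (Equiv.ofBijective planePt planePt_bijective)

lemma coordinatization_inl (x y : F) :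
    coordinatization a (Sum.inl (x, y)) = affPt x (y - a * x ^ 2) := rfl

lemma coordinatization_infPt (o : Option F) :
    coordinatization a (Sum.inr (infPt a o)) = planePt (Sum.inr o) := by
  simp only [coordinatization, Equiv.trans_apply, Equiv.sumCongr_apply, Sum.map_inr,
    Equiv.ofBijective_symm_apply_apply, Equiv.ofBijective_apply]

/-- Two subsets of the closure agree if they contain the same points of the three kinds. -/
lemma closure_set_ext {s t : Set (ClosurePoint (parabolaPlane a))}
    (h1 : ∀ x y, Sum.inl (x, y) ∈ s ↔ Sum.inl (x, y) ∈ t)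
    (h2 : Sum.inr (infPt a none) ∈ s ↔ Sum.inr (infPt a none) ∈ t)
    (h3 : ∀ m, Sum.inr (infPt a (some m)) ∈ s ↔ Sum.inr (infPt a (some m)) ∈ t) : s = t := by
  ext Z
  rcases Z with ⟨x, y⟩ | C
  · exact h1 x y
  · obtain ⟨(_ | m), rfl⟩ := (infPt_bijective a).2 C
    · exact h2
    · exact h3 m

/-- The line of the closure of `𝔄_a` which extends the line `l` of `𝔄_a`. -/
def extendedLine (l : Set (F × F)) : Set (ClosurePoint (parabolaPlane a)) :=
  Sum.inl '' l ∪ Sum.inr '' {C | l ∈ C.1}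

variable {a}

lemma inl_mem_extendedLine {l : Set (F × F)} {p : F × F} :
    Sum.inl p ∈ extendedLine a l ↔ p ∈ l := by
  simp [extendedLine]

lemma inr_mem_extendedLine {l : Set (F × F)} {o : Option F} :
    Sum.inr (infPt a o) ∈ extendedLine a l ↔ l ∈ (infPt a o).1 := by
  simp [extendedLine]

lemma mem_closureLines_iff {s : Set (ClosurePoint (parabolaPlane a))} :
    s ∈ closureLines (parabolaPlane a) ↔
      (∃ k, s = extendedLine a (verticalLine k)) ∨
      (∃ m d, s = extendedLine a (parabola a m d)) ∨ s = Set.range Sum.inr := by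
  constructor
  · rintro (⟨l, ⟨k, rfl⟩ | ⟨m, d, rfl⟩, rfl⟩ | rfl)
    · exact Or.inl ⟨k, rfl⟩
    · exact Or.inr (Or.inl ⟨m, d, rfl⟩)
    · exact Or.inr (Or.inr rfl)
  · rintro (⟨k, rfl⟩ | ⟨m, d, rfl⟩ | rfl)
    · exact Or.inl ⟨_, verticalLine_mem a k, rfl⟩
    · exact Or.inl ⟨_, parabola_mem a m d, rfl⟩
    · exact Or.inr rfl

lemma preimage_lineSet_parabola {c : Fin 3 → F} (h : c 2 ≠ 0) :
    coordinatization a ⁻¹' lineSet c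
      = extendedLine a (parabola a (-(c 1 / c 2)) (-(c 0 / c 2))) := by
  refine closure_set_ext a (fun x y => ?_) ?_ (fun m => ?_)
  · rw [Set.mem_preimage, coordinatization_inl, affPt_mem_lineSet, inl_mem_extendedLine]
    simp only [parabola, Set.mem_ofPred_eq]
    field_simp
    constructor <;> intro h <;> linear_combination h
  · rw [Set.mem_preimage, coordinatization_infPt, planePt, yInf_mem_lineSet,
      inr_mem_extendedLine]
    exact iff_of_false h (parabola_notMem_infPt_none a _ _)
  · rw [Set.mem_preimage, coordinatization_infPt, planePt, slopePt_mem_lineSet,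
      inr_mem_extendedLine, parabola_mem_infPt_some]
    field_simp
    constructor <;> intro h <;> linear_combination -h

lemma preimage_lineSet_vertical {c : Fin 3 → F} (h : c 2 = 0) (h1 : c 1 ≠ 0) :
    coordinatization a ⁻¹' lineSet c = extendedLine a (verticalLine (-(c 0 / c 1))) := by
  refine closure_set_ext a (fun x y => ?_) ?_ (fun m => ?_)
  · rw [Set.mem_preimage, coordinatization_inl, affPt_mem_lineSet, inl_mem_extendedLine]
    simp only [verticalLine, Set.mem_ofPred_eq, h]
    field_simp
    constructor <;> intro h <;> linear_combination h
  · rw [Set.mem_preimage, coordinatization_infPt, planePt, yInf_mem_lineSet,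
      inr_mem_extendedLine]
    exact iff_of_true h (verticalLine_mem_infPt_none a _)
  · rw [Set.mem_preimage, coordinatization_infPt, planePt, slopePt_mem_lineSet,
      inr_mem_extendedLine]
    exact iff_of_false (by simpa [h] using h1) (verticalLine_notMem_infPt_some a _ _)

lemma preimage_lineSet_infinity {c : Fin 3 → F} (h : c 2 = 0) (h1 : c 1 = 0) (h0 : c 0 ≠ 0) :
    coordinatization a ⁻¹' lineSet c = Set.range Sum.inr := by
  refine closure_set_ext a (fun x y => ?_) ?_ (fun m => ?_)
  · rw [Set.mem_preimage, coordinatization_inl, affPt_mem_lineSet]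
    simp [h, h1, h0]
  · rw [Set.mem_preimage, coordinatization_infPt, planePt, yInf_mem_lineSet]
    simp [h]
  · rw [Set.mem_preimage, coordinatization_infPt, planePt, slopePt_mem_lineSet]
    simp [h, h1]

lemma isCoordinatization : IsCoordinatization a (coordinatization a) := by
  refine ⟨fun s => ?_, coordinatization_inl a, coordinatization_infPt a none⟩
  constructor
  · intro hs
    suffices ∃ c : Fin 3 → F, c ≠ 0 ∧ s = coordinatization a ⁻¹' lineSet c by
      obtain ⟨c, hc, rfl⟩ := this
      exact ⟨c, hc, Equiv.image_preimage _ _⟩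
    rcases mem_closureLines_iff.1 hs with ⟨k, rfl⟩ | ⟨m, d, rfl⟩ | rfl
    · refine ⟨![-k, 1, 0], fun h => one_ne_zero (congrFun h 1), ?_⟩
      rw [preimage_lineSet_vertical (by simp) (by simp)]
      simp
    · refine ⟨![-d, -m, 1], fun h => one_ne_zero (congrFun h 2), ?_⟩
      rw [preimage_lineSet_parabola (by simp)]
      simp
    · refine ⟨![1, 0, 0], fun h => one_ne_zero (congrFun h 0), ?_⟩
      rw [preimage_lineSet_infinity (by simp) (by simp) (by simp)]
  · rintro ⟨c, hc, h⟩
    have hs : s = coordinatization a ⁻¹' lineSet c := by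
      rw [lineSet, ← h, Equiv.preimage_image]
    rw [hs, mem_closureLines_iff]
    by_cases h2 : c 2 = 0
    · by_cases h1 : c 1 = 0
      · have h0 : c 0 ≠ 0 := fun h0 => hc (by ext i; fin_cases i <;> simp [h0, h1, h2])
        exact Or.inr (Or.inr (preimage_lineSet_infinity h2 h1 h0))
      · exact Or.inl ⟨_, preimage_lineSet_vertical h2 h1⟩
    · exact Or.inr (Or.inl ⟨_, _, preimage_lineSet_parabola h2⟩)

end Closure

/-! ### `𝒰_b` in the closure of `𝔄_a` -/

section ClosureUnital

variable {K F : Type*} [Field K] [Fintype K] [Field F] [Algebra K F]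

lemma affPt_mem_bmSet {a b x y : F} : affPt x y ∈ bmSet K a b ↔
    y - a * x ^ 2 - b * x ^ (Fintype.card K + 1) ∈ Set.range (algebraMap K F) := by
  simp only [bmSet, Set.mem_union, Set.mem_ofPred_eq, Set.mem_singleton_iff, affPt_ne_yInf,
    or_false, affPt_inj]
  constructor
  · rintro ⟨x', r, rfl, rfl⟩
    exact ⟨r, by ring⟩
  · rintro ⟨r, hr⟩
    exact ⟨x, r, rfl, by rw [hr]; ring⟩

lemma slopePt_notMem_bmSet {a b m : F} : slopePt m ∉ bmSet K a b := by
  rintro (⟨x, r, h⟩ | h)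
  · exact affPt_ne_slopePt _ _ _ h.symm
  · exact slopePt_ne_yInf _ h

lemma yInf_mem_bmSet {a b : F} : yInf F ∈ bmSet K a b := Or.inr rfl

lemma bmSet_zero_left (b : F) : bmSet K 0 b = classicalSet K b := by
  simp [bmSet, classicalSet]

lemma inl_mem_classicalSetInClosure {a b x y : F} :
    Sum.inl (x, y) ∈ classicalSetInClosure K a b ↔
      y - b * x ^ (Fintype.card K + 1) ∈ Set.range (algebraMap K F) := by
  have := affPt_mem_bmSet (K := K) (a := 0) (b := b) (x := x) (y := y)
  rw [bmSet_zero_left, zero_mul, sub_zero] at this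
  simpa [classicalSetInClosure, closureYInf] using this

lemma closureYInf_mem_classicalSetInClosure {a b : F} :
    Sum.inr (infPt a none) ∈ classicalSetInClosure K a b := Or.inr rfl

lemma slope_notMem_classicalSetInClosure {a b m : F} :
    Sum.inr (infPt a (some m)) ∉ classicalSetInClosure K a b := by
  rintro (⟨p, -, h⟩ | h)
  · cases h
  · have h' : infPt a (some m) = infPt a none := Sum.inr_injective h
    cases (infPt_bijective a).1 h'

lemma coordinatization_image (a b : F) :
    coordinatization a '' classicalSetInClosure K a b = bmSet K (-a) b := by
  rw [← Equiv.image_preimage (coordinatization a) (bmSet K (-a) b)]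
  congr 1
  refine closure_set_ext a (fun x y => ?_) ?_ (fun m => ?_)
  · rw [Set.mem_preimage, coordinatization_inl, affPt_mem_bmSet, inl_mem_classicalSetInClosure]
    ring_nf
  · rw [Set.mem_preimage, coordinatization_infPt]
    exact iff_of_true closureYInf_mem_classicalSetInClosure yInf_mem_bmSet
  · rw [Set.mem_preimage, coordinatization_infPt]
    exact iff_of_false slope_notMem_classicalSetInClosure slopePt_notMem_bmSet

/-- The affine part of `𝒰_b` on a vertical line is a coset of `K`. -/
lemma ncard_coset (c : F) : {y : F | y - c ∈ Set.range (algebraMap K F)}.ncard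
    = Fintype.card K := by
  have : {y : F | y - c ∈ Set.range (algebraMap K F)}
      = Set.range fun r : K => c + algebraMap K F r := by
    ext y
    exact exists_congr fun r => ⟨fun h => by simp only [h]; ring, fun h => by simp only [← h]; ring⟩
  rw [this, ← Set.image_univ, Set.ncard_image_of_injective _
    (show Function.Injective fun r : K => c + algebraMap K F r from
      (add_right_injective c).comp (algebraMap K F).injective), Set.ncard_univ,
    Nat.card_eq_fintype_card]

lemma ncard_classicalSetInClosure (hF : Module.finrank K F = 2) (a b : F) :
    (classicalSetInClosure K a b).ncard = Fintype.card K ^ 3 + 1 := by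
  have := finite_of_finrank_eq_two hF
  have := Fintype.ofFinite F
  have hset : classicalSetInClosure K a b = insert (Sum.inr (infPt a none))
      (Set.range fun p : F × K => Sum.inl
        (p.1, b * p.1 ^ (Fintype.card K + 1) + algebraMap K F p.2)) := by
    refine closure_set_ext a (fun x y => ?_) ?_ (fun m => ?_)
    · rw [inl_mem_classicalSetInClosure]
      simp only [Set.mem_range, Set.mem_insert_iff, reduceCtorEq, false_or, Prod.exists,
        Sum.inl.injEq, Prod.mk.injEq]
      constructor
      · rintro ⟨r, hr⟩
        exact ⟨x, r, rfl, by rw [hr]; ring⟩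
      · rintro ⟨x', r, rfl, rfl⟩
        exact ⟨r, by ring⟩
    · exact iff_of_true closureYInf_mem_classicalSetInClosure (Set.mem_insert _ _)
    · refine iff_of_false slope_notMem_classicalSetInClosure ?_
      simp [(infPt_bijective a).1.eq_iff]
  have hinj : Function.Injective fun p : F × K =>
      (Sum.inl (p.1, b * p.1 ^ (Fintype.card K + 1) + algebraMap K F p.2) :
        ClosurePoint (parabolaPlane a)) := by
    rintro ⟨x, r⟩ ⟨x', r'⟩ h
    simp only [Sum.inl.injEq, Prod.mk.injEq] at h
    obtain ⟨rfl, h⟩ := h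
    rw [(algebraMap K F).injective (add_left_cancel h)]
  rw [hset, Set.ncard_insert_of_notMem (by simp) (Set.finite_range _), ← Set.image_univ,
    Set.ncard_image_of_injective _ hinj, Set.ncard_univ, Nat.card_eq_fintype_card,
    Fintype.card_prod, card_eq_sq hF]
  ring

lemma isUnital_classicalSetInClosure (hF : Module.finrank K F = 2) {a b : F}
    (h : Anisotropic K a b) :
    IsUnital (Fintype.card K) (closureLines (parabolaPlane a)) (classicalSetInClosure K a b) := by
  refine ⟨ncard_classicalSetInClosure hF a b, fun l hl => ?_⟩
  have := finite_of_finrank_eq_two hF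
  rcases mem_closureLines_iff.1 hl with ⟨k, rfl⟩ | ⟨m, d, rfl⟩ | rfl
  · right
    have hset : classicalSetInClosure K a b ∩ extendedLine a (verticalLine k)
        = insert (Sum.inr (infPt a none)) ((fun y => Sum.inl (k, y)) ''
          {y : F | y - b * k ^ (Fintype.card K + 1) ∈ Set.range (algebraMap K F)}) := by
      refine closure_set_ext a (fun x y => ?_) ?_ (fun m => ?_)
      · rw [Set.mem_inter_iff, inl_mem_classicalSetInClosure, inl_mem_extendedLine]
        simp only [verticalLine, Set.mem_ofPred_eq, Set.mem_insert_iff, reduceCtorEq, false_or,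
          Set.mem_image, Sum.inl.injEq, Prod.mk.injEq]
        constructor
        · rintro ⟨h, rfl⟩
          exact ⟨y, h, rfl, rfl⟩
        · rintro ⟨y', h, rfl, rfl⟩
          exact ⟨h, rfl⟩
      · exact iff_of_true ⟨closureYInf_mem_classicalSetInClosure,
          inr_mem_extendedLine.2 (verticalLine_mem_infPt_none a k)⟩ (Set.mem_insert _ _)
      · refine iff_of_false (fun h => slope_notMem_classicalSetInClosure h.1) ?_
        simp [(infPt_bijective a).1.eq_iff]
    rw [hset, Set.ncard_insert_of_notMem (by simp) (Set.toFinite _),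
      Set.ncard_image_of_injective _ (fun y y' h => by simpa using h), ncard_coset]
  · have hset : classicalSetInClosure K a b ∩ extendedLine a (parabola a m d)
        = (fun x => Sum.inl (x, a * x ^ 2 + m * x + d)) ''
          {x : F | (-a) * x ^ 2 + b * x ^ (Fintype.card K + 1) + (-m) * x + (-d)
            ∈ Set.range (algebraMap K F)} := by
      refine closure_set_ext a (fun x y => ?_) ?_ (fun m' => ?_)
      · rw [Set.mem_inter_iff, inl_mem_classicalSetInClosure, inl_mem_extendedLine]
        simp only [parabola, Set.mem_ofPred_eq, Set.mem_image, Sum.inl.injEq, Prod.mk.injEq]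
        constructor
        · rintro ⟨⟨r, hr⟩, rfl⟩
          exact ⟨x, ⟨-r, by rw [map_neg, hr]; ring⟩, rfl, rfl⟩
        · rintro ⟨x, ⟨r, hr⟩, rfl, rfl⟩
          exact ⟨⟨-r, by rw [map_neg, hr]; ring⟩, rfl⟩
      · refine iff_of_false (fun h => parabola_notMem_infPt_none a m d
          (inr_mem_extendedLine.1 h.2)) (by simp)
      · exact iff_of_false (fun h => slope_notMem_classicalSetInClosure h.1) (by simp)
    rw [hset, Set.ncard_image_of_injective _ (fun x x' h => by
      simp only [Sum.inl.injEq, Prod.mk.injEq] at h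
      exact h.1)]
    exact (h.neg_left hF).ncard_eq hF (-m) (-d)
  · left
    rw [Set.ncard_eq_one]
    refine ⟨Sum.inr (infPt a none), closure_set_ext a (fun x y => ?_) ?_ (fun m => ?_)⟩
    · simp
    · exact iff_of_true ⟨closureYInf_mem_classicalSetInClosure, Set.mem_range_self _⟩ rfl
    · refine iff_of_false (fun h => slope_notMem_classicalSetInClosure h.1) ?_
      simp [(infPt_bijective a).1.eq_iff]

end ClosureUnital

/-! ### Hermitian curves -/

section Hermitian

variable {K F : Type*} [Field K] [Fintype K] [Field F] [Algebra K F]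

variable (K) in
/-- The sesquilinear expression `∑ vᵢ Hᵢⱼ vⱼ^q`. -/
def herm (H : Matrix (Fin 3) (Fin 3) F) (v : Fin 3 → F) : F :=
  ∑ i, ∑ j, v i * H i j * v j ^ Fintype.card K

lemma herm_smul (H : Matrix (Fin 3) (Fin 3) F) (c : F) (v : Fin 3 → F) :
    herm K H (c • v) = c ^ (Fintype.card K + 1) * herm K H v := by
  simp only [herm, Finset.mul_sum, Pi.smul_apply, smul_eq_mul, mul_pow, pow_succ]
  refine Finset.sum_congr rfl fun i _ => Finset.sum_congr rfl fun j _ => ?_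
  ring

lemma mk_mem_hermSet {H : Matrix (Fin 3) (Fin 3) F} {v : Fin 3 → F} (hv : v ≠ 0) :
    Projectivization.mk F v hv ∈
      {p : PG2 F | ∑ i, ∑ j, p.rep i * H i j * p.rep j ^ Fintype.card K = 0} ↔
      herm K H v = 0 :=
  rep_iff (P := fun v => herm K H v = 0) (fun k v _ h => by rw [herm_smul, h, mul_zero]) hv

lemma isClassicalUnital_bmSet_zero (hF : Module.finrank K F = 2) {b : F}
    (hb : b ∉ Set.range (algebraMap K F)) : IsClassicalUnital K (bmSet K 0 b) := by
  set δ := b ^ Fintype.card K - b with hδ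
  have hδ0 : δ ≠ 0 := fun h => hb ((mem_range_iff b).2 (sub_eq_zero.1 h))
  have hδq : δ ^ Fintype.card K = -δ := by
    rw [hδ, pow_card_sub, pow_card_pow_card hF]
    ring
  have hq : Fintype.card K ≠ 0 := Fintype.card_ne_zero
  refine ⟨!![0, 0, δ⁻¹; 0, -1, 0; -δ⁻¹, 0, 0], ?_, ?_, ?_⟩
  · intro i j
    fin_cases i <;> fin_cases j <;>
      simp [hq, hδq, pow_card_neg, inv_neg]
  · rw [Matrix.det_fin_three]
    simp [hδ0]
  · ext p
    rcases pg2_cases p with ⟨x, y, rfl⟩ | ⟨m, rfl⟩ | rfl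
    · rw [affPt_mem_bmSet, affPt, mk_mem_hermSet, mem_range_iff, zero_mul, sub_zero, pow_card_sub,
        mul_pow]
      simp only [herm, Fin.sum_univ_three, pow_succ x, mul_pow, pow_card_pow_card hF]
      simp only [Matrix.of_apply, Matrix.cons_val', Matrix.cons_val_zero, Matrix.cons_val_one,
        Matrix.cons_val, one_mul, mul_zero, zero_mul, add_zero, zero_add,
        one_pow, mul_one]
      field_simp
      constructor <;> intro h <;> linear_combination h
    · rw [slopePt, mk_mem_hermSet]
      refine iff_of_false slopePt_notMem_bmSet ?_
      simp [herm, Fin.sum_univ_three, hq]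
    · rw [yInf, mk_mem_hermSet]
      refine iff_of_true yInf_mem_bmSet ?_
      simp [herm, Fin.sum_univ_three, hq]

/-- The equation of `U_{a,b}` over the points `(1, x, a x² + b x^{q+1})` has degree `2q < q²` in
`x`, so that the coefficient of `x²` of a Hermitian form which vanishes on it is zero. -/
lemma not_isClassicalUnital_bmSet (hF : Module.finrank K F = 2) (hq2 : 2 < Fintype.card K)
    {a b : F} (ha : a ≠ 0) : ¬ IsClassicalUnital K (bmSet K a b) := by
  rintro ⟨H, -, -, hU⟩
  have hq : Fintype.card K ≠ 0 := Fintype.card_ne_zero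
  have hmem : ∀ x y : F, y - a * x ^ 2 - b * x ^ (Fintype.card K + 1)
      ∈ Set.range (algebraMap K F) ↔ herm K H ![1, x, y] = 0 := fun x y => by
    rw [← affPt_mem_bmSet, hU, affPt, mk_mem_hermSet]
  have hval : ∀ x y : F, herm K H ![1, x, y] =
      H 0 0 + H 0 1 * x ^ Fintype.card K + H 0 2 * y ^ Fintype.card K
      + x * H 1 0 + x * H 1 1 * x ^ Fintype.card K + x * H 1 2 * y ^ Fintype.card K
      + y * H 2 0 + y * H 2 1 * x ^ Fintype.card K + y * H 2 2 * y ^ Fintype.card K := by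
    intro x y
    simp [herm, Fin.sum_univ_three]
    ring
  have h22 : H 2 2 = 0 := by
    have h : yInf F ∈ bmSet K a b := yInf_mem_bmSet
    rw [hU, yInf, mk_mem_hermSet] at h
    simpa [herm, Fin.sum_univ_three, hq] using h
  have hzero : ∀ (x : F) (r : K),
      herm K H ![1, x, a * x ^ 2 + b * x ^ (Fintype.card K + 1) + algebraMap K F r] = 0 :=
    fun x r => (hmem x _).1 ⟨r, by ring⟩
  -- Each vertical line meets the set in a coset of `K`, so the terms in `y` are proportional
  -- to `y ^ q - y`.
  have hlin : ∀ x : F, H 0 2 + H 2 0 + x * H 1 2 + x ^ Fintype.card K * H 2 1 = 0 := by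
    intro x
    have h0 := hzero x 0
    have h1 := hzero x 1
    rw [hval, h22] at h0 h1
    simp only [map_zero, map_one, add_zero] at h0 h1
    rw [pow_card_add (_ + _) (1 : F), one_pow] at h1
    linear_combination h1 - h0
  obtain ⟨e, he⟩ := exists_notMem_range hF
  have hs0 : H 0 2 + H 2 0 = 0 := by simpa [hq] using hlin 0
  have hs1 : H 1 2 + H 2 1 = 0 := by
    have := hlin 1
    rw [one_pow] at this
    linear_combination this - hs0
  have h12 : H 1 2 = 0 := by
    have h := hlin e
    have h' : H 1 2 * (e - e ^ Fintype.card K) = 0 := by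
      linear_combination h - hs0 - e ^ Fintype.card K * hs1
    refine (mul_eq_zero.1 h').resolve_right fun h0 => he ((mem_range_iff e).2 ?_)
    linear_combination -h0
  have h21 : H 2 1 = 0 := by linear_combination hs1 - h12
  have h20 : H 2 0 = -H 0 2 := by linear_combination hs0
  have h02 : H 0 2 ≠ 0 := by
    intro h02
    have h0 := (hmem 0 0).1 ⟨0, by simp⟩
    have he' := mt (hmem 0 e).2 (by simpa using he)
    rw [hval] at h0 he'
    simp [h20, h02, h21, h12, h22, hq] at h0 he'
    exact he' h0
  let P : Polynomial F := .C (H 0 0) + .C (H 1 0) * .X ^ 1 + .C (H 0 1) * .X ^ Fintype.card K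
    + .C (H 1 1 + H 0 2 * (b ^ Fintype.card K - b)) * .X ^ (Fintype.card K + 1)
    + .C (H 0 2 * a ^ Fintype.card K) * .X ^ (2 * Fintype.card K) + .C (-(H 0 2 * a)) * .X ^ 2
  have hPeval : ∀ x, P.eval x = 0 := by
    intro x
    have h0 := hzero x 0
    rw [hval, h22, h12, h21, h20, map_zero, add_zero, pow_card_add, mul_pow, mul_pow,
      pow_succ x (Fintype.card K), mul_pow, pow_card_pow_card hF] at h0
    simp only [P, Polynomial.eval_add, Polynomial.eval_mul, Polynomial.eval_C,
      Polynomial.eval_pow, Polynomial.eval_X]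
    rw [← h0]
    ring
  have := finite_of_finrank_eq_two hF
  have := Fintype.ofFinite F
  have hmono : ∀ (c : F) (n : ℕ), n ≤ 2 * Fintype.card K →
      (Polynomial.C c * Polynomial.X ^ n).natDegree ≤ 2 * Fintype.card K :=
    fun c n hn => (Polynomial.natDegree_C_mul_X_pow_le c n).trans hn
  have hdeg : P.natDegree ≤ 2 * Fintype.card K := by
    refine Polynomial.natDegree_add_le_of_degree_le (Polynomial.natDegree_add_le_of_degree_le
      (Polynomial.natDegree_add_le_of_degree_le (Polynomial.natDegree_add_le_of_degree_le
      (Polynomial.natDegree_add_le_of_degree_le ?_ ?_) ?_) ?_) ?_) ?_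
    · simp
    all_goals exact hmono _ _ (by omega)
  have hP : P = 0 := by
    refine Polynomial.eq_zero_of_natDegree_lt_card_of_eval_eq_zero P
      (f := (id : F → F)) Function.injective_id hPeval (hdeg.trans_lt ?_)
    rw [card_eq_sq hF, sq]
    exact Nat.mul_lt_mul_of_pos_right hq2 (by omega)
  have hcoeff := congrArg (fun p => Polynomial.coeff p 2) hP
  have e1 : 2 ≠ Fintype.card K := by omega
  have e2 : 2 ≠ 2 * Fintype.card K := by omega
  have e3 : 2 ≠ Fintype.card K + 1 := by omega
  simp only [P, Polynomial.coeff_add, Polynomial.coeff_C_mul, Polynomial.coeff_X_pow,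
    Polynomial.coeff_C, e1, e2, e3, if_false, if_true, Polynomial.coeff_zero] at hcoeff
  simp [h02, ha] at hcoeff

end Hermitian

/-! ### Cones in the Bruck–Bose representation -/

section Cone

variable {K M : Type*} [Field K] [AddCommGroup M] [Module K M]

lemma mk_mem_projCone {v : Fin 4 → M} (hv : LinearIndependent K v) (V : ℙ K M) (α β γ : K)
    {z : M} (hz : z ≠ 0) :
    Projectivization.mk K z hz ∈ projCone V {p | ∃ c : Fin 4 → K, p.rep = ∑ i, c i • v i ∧
        c 0 * c 1 + (α * c 2 ^ 2 + β * c 2 * c 3 + γ * c 3 ^ 2) = 0} ↔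
      ∃ (c : Fin 4 → K) (k : K), z = ∑ i, c i • v i + k • V.rep ∧
        c 0 * c 1 + (α * c 2 ^ 2 + β * c 2 * c 3 + γ * c 3 ^ 2) = 0 := by
  have hO : ∀ {w : M} (hw : w ≠ 0), Projectivization.mk K w hw ∈ {p : ℙ K M |
      ∃ c : Fin 4 → K, p.rep = ∑ i, c i • v i ∧
        c 0 * c 1 + (α * c 2 ^ 2 + β * c 2 * c 3 + γ * c 3 ^ 2) = 0} ↔
      ∃ c : Fin 4 → K, w = ∑ i, c i • v i ∧
        c 0 * c 1 + (α * c 2 ^ 2 + β * c 2 * c 3 + γ * c 3 ^ 2) = 0 := by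
    intro w hw
    refine rep_iff (L := K) (P := fun w : M => ∃ c : Fin 4 → K, w = ∑ i, c i • v i ∧
        c 0 * c 1 + (α * c 2 ^ 2 + β * c 2 * c 3 + γ * c 3 ^ 2) = 0) ?_ hw
    rintro s w - ⟨c, rfl, hc⟩
    refine ⟨s • c, ?_, ?_⟩
    · simp only [Finset.smul_sum, smul_smul, Pi.smul_apply, smul_eq_mul]
    · simp only [Pi.smul_apply, smul_eq_mul]
      linear_combination s ^ 2 * hc
  constructor
  · rintro ⟨o, ⟨c, ho, hc⟩, hle⟩
    have hzm : z ∈ V.submodule ⊔ o.submodule :=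
      hle (by rw [Projectivization.submodule_mk]; exact Submodule.mem_span_singleton_self z)
    rw [Projectivization.submodule_eq, Projectivization.submodule_eq, Submodule.mem_sup] at hzm
    obtain ⟨_, h1, _, h2, rfl⟩ := hzm
    obtain ⟨k, rfl⟩ := Submodule.mem_span_singleton.1 h1
    obtain ⟨s, rfl⟩ := Submodule.mem_span_singleton.1 h2
    refine ⟨s • c, k, ?_, ?_⟩
    · rw [ho, add_comm]
      simp only [Finset.smul_sum, smul_smul, Pi.smul_apply, smul_eq_mul]
    · simp only [Pi.smul_apply, smul_eq_mul]
      linear_combination s ^ 2 * hc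
  · rintro ⟨c, k, rfl, hc⟩
    by_cases hw : ∑ i, c i • v i = 0
    · refine ⟨Projectivization.mk K (v 0) (hv.ne_zero 0),
        (hO _).2 ⟨Pi.single 0 1, by simp [Pi.single_apply], by simp⟩, ?_⟩
      rw [Projectivization.submodule_mk, Projectivization.submodule_eq V,
        Submodule.span_singleton_le_iff_mem, hw, zero_add]
      exact Submodule.mem_sup_left (Submodule.smul_mem _ _ (Submodule.mem_span_singleton_self _))
    · refine ⟨Projectivization.mk K _ hw, (hO _).2 ⟨c, rfl, hc⟩, ?_⟩
      rw [Projectivization.submodule_mk, Projectivization.submodule_mk,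
        Projectivization.submodule_eq V, Submodule.span_singleton_le_iff_mem]
      exact Submodule.add_mem _ (Submodule.mem_sup_right (Submodule.mem_span_singleton_self _))
        (Submodule.mem_sup_left (Submodule.smul_mem _ _ (Submodule.mem_span_singleton_self _)))

variable {F : Type*} [Field F] [Algebra K F]

lemma mk_mem_spreadLine {u w : F} {z : K × F × F} (hz : z ≠ 0) :
    Projectivization.mk K z hz ∈ spreadLine K u w ↔ ∃ t : F, z = (0, t * u, t * w) := by
  refine rep_iff (L := K) (P := fun z : K × F × F => ∃ t : F, z = (0, t * u, t * w)) ?_ hz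
  rintro s z - ⟨t, rfl⟩
  exact ⟨s • t, by simp⟩

lemma mk_mem_solidAtInfinity {z : K × F × F} (hz : z ≠ 0) :
    Projectivization.mk K z hz ∈ solidAtInfinity K F ↔ z.1 = 0 := by
  refine rep_iff (L := K) (P := fun z : K × F × F => z.1 = 0) ?_ hz
  intro s z _ h
  change z.1 = 0 at h
  simp [h]

end Cone

section ConeOfUnital

variable {K F : Type*} [Field K] [Fintype K] [Field F] [Algebra K F]

/-- The set `U_{a,b}` is represented by the cone `φ (a x² + b x^{q+1}) = t φ (y)`. -/
lemma isBuekenhoutMetzSet_bmSet (hF : Module.finrank K F = 2) {a b : F}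
    (h : Anisotropic K a b) : IsBuekenhoutMetzSet K (bmSet K a b) := by
  obtain ⟨e, φ, he, hk, hy⟩ := exists_coord hF
  have hk1 : φ 1 = 0 := by simpa using hk 1
  have hli : ∀ s t : K, s • (1 : F) + t • e = 0 → s = 0 ∧ t = 0 := by
    intro s t hst
    have ht : t = 0 := by simpa [he, hk1] using congrArg φ hst
    subst ht
    simpa using hst
  set N := quadForm φ a b with hN
  have hN0 := h.eq_zero_of_quadForm hk hy
  have hNval : ∀ s t : K, N (s • 1 + t • e)
      = N 1 * s ^ 2 + QuadraticMap.polar N 1 e * s * t + N e * t ^ 2 := by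
    intro s t
    rw [QuadraticMap.map_add N]
    simp only [QuadraticMap.map_smul, QuadraticMap.polar_smul_left,
      QuadraticMap.polar_smul_right, smul_eq_mul]
    ring
  let v : Fin 4 → K × F × F := ![(1, 0, 0), (0, 0, -e), (0, 1, 0), (0, e, 0)]
  have hsum : ∀ c : Fin 4 → K,
      ∑ i, c i • v i = (c 0, c 2 • (1 : F) + c 3 • e, -(c 1 • e)) := by
    intro c
    simp [v, Fin.sum_univ_four]
  have hv : LinearIndependent K v := by
    rw [Fintype.linearIndependent_iff]
    intro c hc
    rw [hsum, Prod.mk_eq_zero, Prod.mk_eq_zero] at hc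
    obtain ⟨h0, h23, h1⟩ := hc
    obtain ⟨h2, h3⟩ := hli _ _ h23
    have h1 : c 1 = 0 := by simpa [he] using congrArg φ h1
    intro i
    fin_cases i <;> assumption
  have hV0 : ((0 : K), (0 : F), (1 : F)) ≠ 0 := by simp
  let V : PG4 K F := Projectivization.mk K _ hV0
  obtain ⟨s, hs⟩ := Projectivization.exists_smul_eq_mk_rep K _ hV0
  have hVrep : V.rep = (0, 0, algebraMap K F s) := by
    rw [← hs, Units.smul_def, Algebra.algebraMap_eq_smul_one]
    simp
  let O : Set (PG4 K F) := {p | ∃ c : Fin 4 → K, p.rep = ∑ i, c i • v i ∧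
    c 0 * c 1 + (N 1 * c 2 ^ 2 + QuadraticMap.polar N 1 e * c 2 * c 3 + N e * c 3 ^ 2) = 0}
  have hcone : ∀ {t : K} {x y : F} (hz : (t, x, y) ≠ 0),
      Projectivization.mk K (t, x, y) hz ∈ projCone V O ↔ N x = t * φ y := by
    intro t x y hz
    rw [mk_mem_projCone hv]
    constructor
    · rintro ⟨c, k, hc, hq⟩
      rw [hsum, hVrep] at hc
      simp only [Prod.smul_mk, smul_zero, Prod.mk_add_mk, add_zero, Prod.mk.injEq] at hc
      obtain ⟨rfl, rfl, rfl⟩ := hc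
      rw [hNval]
      simp only [map_add, map_neg, map_smul, he, hk, smul_eq_mul, mul_one]
      linear_combination hq
    · intro hq
      obtain ⟨k, hky⟩ := hy y
      -- The vectors `1` and `e` form a basis of `F`, with `φ` as second coordinate.
      obtain ⟨k', hkx⟩ := hy x
      rw [Algebra.algebraMap_eq_smul_one] at hkx
      refine ⟨![t, -φ y, k', φ x], k / s, ?_, ?_⟩
      · rw [hsum, hVrep]
        simp only [Matrix.cons_val_zero, Matrix.cons_val_one, Matrix.cons_val, Prod.smul_mk,
          smul_zero, Prod.mk_add_mk, add_zero, ← hkx, Prod.mk.injEq, true_and]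
        rw [neg_smul, neg_neg, Algebra.smul_def (k / (s : K)), ← map_mul,
          div_mul_cancel₀ _ s.ne_zero, add_comm]
        exact hky
      · have := hNval k' (φ x)
        rw [← hkx, hq] at this
        simp only [Matrix.cons_val_zero, Matrix.cons_val_one, Matrix.cons_val]
        linear_combination -this
  have hw : (![0, 0, 1] : Fin 3 → F) ≠ 0 := fun h => one_ne_zero (congrFun h 2)
  refine ⟨v, O, V, 0, 1, hw, hv, ⟨_, _, _, fun s t hst => hli s t (hN0 _ ?_), rfl⟩, ?_, ?_, ?_,
    ?_⟩
  · rw [← hN, hNval, hst]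
  · rw [Submodule.mem_span_range_iff_exists_fun, hVrep]
    rintro ⟨c, hc⟩
    rw [hsum] at hc
    simp only [Prod.mk.injEq] at hc
    have h1 := congrArg φ hc.2.2
    rw [hk, map_neg, map_smul, he, smul_eq_mul, mul_one, neg_eq_zero] at h1
    have h2 := hc.2.2
    rw [h1, zero_smul, neg_zero, eq_comm, map_eq_zero] at h2
    exact s.ne_zero h2
  · exact (mk_mem_spreadLine hV0).2 ⟨1, by simp⟩
  · ext p
    induction p using Projectivization.ind with
    | h z hz =>
      obtain ⟨t, x, y⟩ := z
      rw [Set.mem_inter_iff, hcone, mk_mem_solidAtInfinity, mk_mem_spreadLine]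
      simp only [mul_zero, mul_one, Prod.mk.injEq]
      constructor
      · rintro ⟨hq, rfl⟩
        exact ⟨y, rfl, hN0 x (by rw [hq, zero_mul]), rfl⟩
      · rintro ⟨_, rfl, rfl, rfl⟩
        simp
  · ext p
    simp only [Set.mem_union, Set.mem_ofPred_eq, Set.mem_singleton_iff]
    have haff : ∀ x y : F, affPt x y ∈ bmSet K a b ↔ bruckBosePt K x y ∈ projCone V O := by
      intro x y
      rw [affPt_mem_bmSet, bruckBosePt, hcone, mem_range_iff_coord hk hy, hN, quadForm_apply,
        one_mul, sub_sub, map_sub, sub_eq_zero, eq_comm]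
    constructor
    · rintro (⟨x, r, rfl⟩ | hp)
      · exact Or.inl ⟨_, _, rfl, (haff _ _).1 (Or.inl ⟨x, r, rfl⟩)⟩
      · exact Or.inr hp
    · rintro (⟨x, y, rfl, hp⟩ | hp)
      · exact (haff _ _).2 hp
      · exact Or.inr hp

lemma projectivity_refl {F : Type*} [Field F] :
    projectivity (LinearEquiv.refl F (Fin 3 → F)) = id :=
  Projectivization.map_id

lemma isBMUnital_bmSet (hF : Module.finrank K F = 2) {a b : F} (h : Anisotropic K a b) :
    IsBMUnital K (bmSet K a b) :=
  ⟨LinearEquiv.refl F _, by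
    rw [projectivity_refl, Set.image_id]
    exact isBuekenhoutMetzSet_bmSet hF h⟩

end ConeOfUnital

/-! ### Projectivities -/

section Projectivities

variable {F : Type*} [Field F]

lemma projectivity_mk (g : (Fin 3 → F) ≃ₗ[F] (Fin 3 → F)) {v : Fin 3 → F} (hv : v ≠ 0) :
    projectivity g (Projectivization.mk F v hv)
      = Projectivization.mk F (g v) (g.map_ne_zero_iff.2 hv) := rfl

lemma projectivity_symm_apply (g : (Fin 3 → F) ≃ₗ[F] (Fin 3 → F)) (p : PG2 F) :
    projectivity g.symm (projectivity g p) = p := by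
  induction p using Projectivization.ind with
  | h v hv => simp [projectivity_mk]

lemma projectivity_apply_symm (g : (Fin 3 → F) ≃ₗ[F] (Fin 3 → F)) (p : PG2 F) :
    projectivity g (projectivity g.symm p) = p :=
  projectivity_symm_apply g.symm p

lemma mem_projectivity_image {g : (Fin 3 → F) ≃ₗ[F] (Fin 3 → F)} {S : Set (PG2 F)} {p : PG2 F} :
    p ∈ projectivity g '' S ↔ projectivity g.symm p ∈ S := by
  constructor
  · rintro ⟨p, hp, rfl⟩
    rwa [projectivity_symm_apply]
  · exact fun hp => ⟨_, hp, projectivity_apply_symm g p⟩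

lemma projectivity_trans_image (g h : (Fin 3 → F) ≃ₗ[F] (Fin 3 → F)) (S : Set (PG2 F)) :
    projectivity (g.trans h) '' S = projectivity h '' (projectivity g '' S) := by
  rw [Set.image_image]
  refine Set.image_congr fun p _ => ?_
  induction p using Projectivization.ind with
  | h v hv => rfl

lemma projectivity_symm_image (g : (Fin 3 → F) ≃ₗ[F] (Fin 3 → F)) (S : Set (PG2 F)) :
    projectivity g.symm '' (projectivity g '' S) = S := by
  rw [Set.image_image]
  simp [projectivity_symm_apply]

lemma mulVec_toMatrix_symm (g : (Fin 3 → F) ≃ₗ[F] (Fin 3 → F)) :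
    ∃ M : Matrix (Fin 3) (Fin 3) F, M.det ≠ 0 ∧ ∀ v, g.symm v = M.mulVec v := by
  refine ⟨LinearMap.toMatrix' g.symm.toLinearMap, ?_, fun v => ?_⟩
  · rw [LinearMap.det_toMatrix']
    exact (LinearEquiv.isUnit_det' g.symm).ne_zero
  · rw [LinearMap.toMatrix'_mulVec]
    rfl

lemma isConic_image {C : Set (PG2 F)} (hC : IsConic C) (g : (Fin 3 → F) ≃ₗ[F] (Fin 3 → F)) :
    IsConic (projectivity g '' C) := by
  obtain ⟨A, hA, hdet, rfl⟩ := hC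
  obtain ⟨M, hM, hg⟩ := mulVec_toMatrix_symm g
  refine ⟨M.transpose * A * M, ?_, ?_, ?_⟩
  · rw [Matrix.IsSymm, Matrix.transpose_mul, Matrix.transpose_mul, Matrix.transpose_transpose,
      hA.eq, Matrix.mul_assoc]
  · rw [Matrix.det_mul, Matrix.det_mul, Matrix.det_transpose]
    exact mul_ne_zero (mul_ne_zero hM hdet) hM
  · have key : ∀ (B : Matrix (Fin 3) (Fin 3) F) {v : Fin 3 → F} (hv : v ≠ 0),
        Projectivization.mk F v hv ∈ {p : PG2 F | p.rep ⬝ᵥ B.mulVec p.rep = 0} ↔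
          v ⬝ᵥ B.mulVec v = 0 := fun B v hv =>
      rep_iff (L := F) (P := fun v => v ⬝ᵥ B.mulVec v = 0) (fun c v _ h => by
        change v ⬝ᵥ B.mulVec v = 0 at h
        simp [Matrix.mulVec_smul, h]) hv
    ext p
    rw [mem_projectivity_image]
    induction p using Projectivization.ind with
    | h v hv =>
      rw [projectivity_mk, key, key, hg, ← Matrix.mulVec_mulVec, ← Matrix.mulVec_mulVec,
        Matrix.mulVec_transpose, dotProduct_comm v, ← Matrix.dotProduct_mulVec, dotProduct_comm]

variable {K : Type*} [Field K] [Fintype K] [Algebra K F]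

lemma isClassicalUnital_image (hF : Module.finrank K F = 2) {U : Set (PG2 F)}
    (hU : IsClassicalUnital K U) (g : (Fin 3 → F) ≃ₗ[F] (Fin 3 → F)) :
    IsClassicalUnital K (projectivity g '' U) := by
  obtain ⟨H, hH, hdet, rfl⟩ := hU
  obtain ⟨M, hM, hg⟩ := mulVec_toMatrix_symm g
  let σ : F →+* F := (FiniteField.frobeniusAlgHom K F : F →+* F)
  have hσ : ∀ x, σ x = x ^ Fintype.card K := fun x => rfl
  have hσσ : (M.map σ).map σ = M := by
    ext i j
    simp only [Matrix.map_apply, hσ, pow_card_pow_card hF]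
  have hHσ : H.map σ = H.transpose := by
    ext i j
    exact (hH i j).symm
  have hherm : ∀ (B : Matrix (Fin 3) (Fin 3) F) (v : Fin 3 → F),
      herm K B v = v ⬝ᵥ B.mulVec (σ ∘ v) := by
    intro B v
    simp only [herm, dotProduct, Matrix.mulVec, Finset.mul_sum, Function.comp, hσ, mul_assoc]
  refine ⟨M.transpose * H * M.map σ, ?_, ?_, ?_⟩
  · have : (M.transpose * H * M.map σ).map σ = (M.transpose * H * M.map σ).transpose := by
      rw [Matrix.map_mul, Matrix.map_mul, hσσ, hHσ, Matrix.transpose_mul, Matrix.transpose_mul,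
        Matrix.transpose_transpose, Matrix.transpose_map, Matrix.mul_assoc]
    intro i j
    rw [← hσ, ← Matrix.map_apply (f := σ), this, Matrix.transpose_apply]
  · rw [Matrix.det_mul, Matrix.det_mul, Matrix.det_transpose, ← RingHom.mapMatrix_apply,
      ← RingHom.map_det]
    exact mul_ne_zero (mul_ne_zero hM hdet) ((map_ne_zero σ).2 hM)
  · ext p
    rw [mem_projectivity_image]
    induction p using Projectivization.ind with
    | h v hv =>
      have hcomp : σ ∘ M.mulVec v = (M.map σ).mulVec (σ ∘ v) := by
        ext i
        simp [Matrix.mulVec, dotProduct]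
      rw [projectivity_mk, mk_mem_hermSet, mk_mem_hermSet, hherm, hherm]
      change g.symm v ⬝ᵥ H.mulVec (σ ∘ g.symm v) = 0 ↔ _
      rw [hg, hcomp, ← Matrix.mulVec_mulVec, ← Matrix.mulVec_mulVec,
        Matrix.mulVec_transpose, dotProduct_comm v, ← Matrix.dotProduct_mulVec, dotProduct_comm]

end Projectivities

/-! ### The unitals of Hirschfeld–Szőnyi type -/

section HirschfeldSzonyi

variable {K F : Type*} [Field K] [Fintype K] [Field F] [Algebra K F]

/-- The conic `y = a x² + r`, in homogeneous coordinates. -/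
def conic (a r : F) : Set (PG2 F) :=
  {p | p.rep ⬝ᵥ (!![2 * r, 0, -1; 0, 2 * a, 0; -1, 0, 0] : Matrix _ _ F).mulVec p.rep = 0}

lemma mk_mem_conic (h2 : (2 : F) ≠ 0) {a r : F} {v : Fin 3 → F} (hv : v ≠ 0) :
    Projectivization.mk F v hv ∈ conic a r ↔ a * v 1 ^ 2 + r * v 0 ^ 2 = v 0 * v 2 := by
  have h := rep_iff (L := F) (P := fun v : Fin 3 → F =>
    v ⬝ᵥ (!![2 * r, 0, -1; 0, 2 * a, 0; -1, 0, 0] : Matrix _ _ F).mulVec v = 0)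
    (fun c v _ h => by
      change v ⬝ᵥ Matrix.mulVec _ v = 0 at h
      change (c • v) ⬝ᵥ Matrix.mulVec _ (c • v) = 0
      rw [Matrix.mulVec_smul, dotProduct_smul, smul_dotProduct, h, smul_zero, smul_zero]) hv
  refine h.trans ?_
  simp only [dotProduct, Matrix.mulVec, Fin.sum_univ_three, Matrix.of_apply, Matrix.cons_val',
    Matrix.cons_val_zero, Matrix.cons_val_one, Matrix.cons_val]
  constructor
  · intro h
    apply mul_left_cancel₀ h2
    linear_combination h
  · intro h
    linear_combination 2 * h

lemma isConic_conic (h2 : (2 : F) ≠ 0) {a : F} (ha : a ≠ 0) (r : F) : IsConic (conic a r) := by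
  refine ⟨!![2 * r, 0, -1; 0, 2 * a, 0; -1, 0, 0], ?_, ?_, rfl⟩
  · ext i j
    fin_cases i <;> fin_cases j <;> simp
  · rw [Matrix.det_fin_three]
    simp [h2, ha]

lemma affPt_mem_conic (h2 : (2 : F) ≠ 0) {a r x y : F} :
    affPt x y ∈ conic a r ↔ y = a * x ^ 2 + r := by
  rw [affPt, mk_mem_conic h2]
  simp [eq_comm]

/-- For `b ∈ K` the term `b x^{q+1}` lies in `K`, and `U_{a,b}` is the union of the conics
`y = a x² + r` with `r ∈ K`. -/
lemma bmSet_eq_iUnion_conic (hF : Module.finrank K F = 2) (h2 : (2 : F) ≠ 0) {a : F}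
    (ha : a ≠ 0) (b : K) :
    bmSet K a (algebraMap K F b) = ⋃ r : K, conic a (algebraMap K F r) := by
  ext p
  rw [Set.mem_iUnion]
  rcases pg2_cases p with ⟨x, y, rfl⟩ | ⟨m, rfl⟩ | rfl
  · obtain ⟨n, hn⟩ := exists_norm (K := K) hF x
    simp only [affPt_mem_bmSet, affPt_mem_conic h2, ← hn]
    constructor
    · rintro ⟨r, hr⟩
      exact ⟨r + b * n, by rw [map_add, map_mul, hr]; ring⟩
    · rintro ⟨r, hr⟩
      exact ⟨r - b * n, by rw [map_sub, map_mul, hr]; ring⟩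
  · refine iff_of_false slopePt_notMem_bmSet ?_
    rintro ⟨r, hr⟩
    rw [slopePt, mk_mem_conic h2] at hr
    simp [ha] at hr
  · refine iff_of_true yInf_mem_bmSet ⟨0, ?_⟩
    rw [yInf, mk_mem_conic h2]
    simp

lemma two_ne_zero_of_odd (hq : Odd (Fintype.card K)) : (2 : F) ≠ 0 := by
  have hchar : ringChar K ≠ 2 := fun h =>
    (Nat.not_even_iff_odd.2 hq) (Nat.even_iff.2 (FiniteField.even_card_iff_char_two.1 h))
  have h2 : (2 : K) ≠ 0 := Ring.two_ne_zero hchar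
  intro h
  apply h2
  rwa [← map_eq_zero (algebraMap K F), map_ofNat]

lemma isHSzType_image (hF : Module.finrank K F = 2) (hq : Odd (Fintype.card K)) {a : F}
    (ha : a ≠ 0) (b : K) (g : (Fin 3 → F) ≃ₗ[F] (Fin 3 → F))
    (hU : IsBMUnital K (projectivity g '' bmSet K a (algebraMap K F b))) :
    IsHSzType K (projectivity g '' bmSet K a (algebraMap K F b)) := by
  have h2 : (2 : F) ≠ 0 := two_ne_zero_of_odd hq
  let s : Fin (Fintype.card K) ≃ K := (Fintype.equivFin K).symm
  refine ⟨hq, hU, fun i => projectivity g '' conic a (algebraMap K F (s i)), ?_,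
    fun i => isConic_image (isConic_conic h2 ha _) g, ⟨projectivity g (yInf F), fun i => ?_⟩, ?_⟩
  · intro i j hij
    have hij := congrArg (fun S => projectivity g.symm '' S) hij
    simp only [projectivity_symm_image] at hij
    have h0 : affPt 0 (algebraMap K F (s i)) ∈ conic a (algebraMap K F (s j)) := by
      rw [← hij, affPt_mem_conic h2]
      ring
    rw [affPt_mem_conic h2] at h0
    apply s.injective
    apply (algebraMap K F).injective
    linear_combination h0
  · refine ⟨_, ?_, rfl⟩
    rw [yInf, mk_mem_conic h2]
    simp
  · rw [bmSet_eq_iUnion_conic hF h2 ha, Set.image_iUnion]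
    exact (s.surjective.iUnion_comp fun r => projectivity g '' conic a (algebraMap K F r)).symm

end HirschfeldSzonyi

/-! ### Normal form of a Buekenhout–Metz set -/

section NormalForm

variable {K F : Type*} [Field K] [Field F] [Algebra K F]

/-- The equation `Q = 0` of the cone of a Buekenhout–Metz set. The vertex is `(0, u, w)`, the
radical of `Q`. -/
lemma exists_quadraticForm_of_isBuekenhoutMetzSet (hF : Module.finrank K F = 2) {U : Set (PG2 F)}
    (hU : IsBuekenhoutMetzSet K U) :
    ∃ (Q : QuadraticForm K (K × F × F)) (u w : F) (h : (![0, u, w] : Fin 3 → F) ≠ 0),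
      (∀ x y, Q (0, x, y) = 0 ↔ ∃ t : F, x = t * u ∧ y = t * w) ∧
      (∀ z, (∀ z', Q (z' + z) = Q z') ↔ ∃ k : K, z = k • (0, u, w)) ∧
      U = {p | ∃ x y : F, p = affPt x y ∧ Q (1, x, y) = 0} ∪
        {Projectivization.mk F ![0, u, w] h} := by
  obtain ⟨v, O, V, u, w, huw, hv, ⟨α, β, γ, hf, rfl⟩, hV, hVs, hinf, rfl⟩ := hU
  obtain ⟨t₀, ht₀⟩ := hVs
  have ht₀' : t₀ ≠ 0 := by
    rintro rfl
    exact V.rep_nonzero (by rw [ht₀]; simp)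
  have : Module.Finite K F := Module.finite_of_finrank_pos (by omega)
  have hli : LinearIndependent K (Fin.cons V.rep v : Fin 5 → K × F × F) :=
    linearIndependent_finCons.2 ⟨hv, hV⟩
  let B := basisOfLinearIndependentOfCardEqFinrank hli (by simp [hF])
  have hB0 : B 0 = V.rep := by simp [B]
  have hBs : ∀ i : Fin 4, B i.succ = v i := by simp [B]
  let Q : QuadraticForm K (K × F × F) :=
    QuadraticMap.linMulLin (B.coord 1) (B.coord 2)
      + (α • QuadraticMap.linMulLin (B.coord 3) (B.coord 3)
      + β • QuadraticMap.linMulLin (B.coord 3) (B.coord 4)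
      + γ • QuadraticMap.linMulLin (B.coord 4) (B.coord 4))
  have hQ : ∀ z, Q z = B.coord 1 z * B.coord 2 z + (α * B.coord 3 z ^ 2
      + β * B.coord 3 z * B.coord 4 z + γ * B.coord 4 z ^ 2) := by
    intro z
    simp only [Q, add_apply, smul_apply, QuadraticMap.linMulLin_apply,
      smul_eq_mul]
    ring
  have hcoord : ∀ (c : Fin 4 → K) (k : K) (i : Fin 4),
      B.coord i.succ (∑ i, c i • v i + k • V.rep) = c i := by
    intro c k i
    simp_rw [← hBs, ← hB0]
    simp [Finsupp.single_apply, Fin.succ_ne_zero]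
  have hexp : ∀ z, z = ∑ i : Fin 4, B.coord i.succ z • v i + B.coord 0 z • V.rep := by
    intro z
    conv_lhs => rw [← B.sum_repr z, Fin.sum_univ_succ]
    simp_rw [hBs, hB0]
    rw [add_comm]
    rfl
  have hQc : ∀ (c : Fin 4 → K) (k : K), Q (∑ i, c i • v i + k • V.rep)
      = c 0 * c 1 + (α * c 2 ^ 2 + β * c 2 * c 3 + γ * c 3 ^ 2) := by
    intro c k
    rw [hQ]
    have h0 := hcoord c k 0
    have h1 := hcoord c k 1
    have h2 := hcoord c k 2
    have h3 := hcoord c k 3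
    simp only [Fin.succ_zero_eq_one] at h0
    rw [show (1 : Fin 4).succ = 2 from rfl] at h1
    rw [show (2 : Fin 4).succ = 3 from rfl] at h2
    rw [show (3 : Fin 4).succ = 4 from rfl] at h3
    rw [h0, h1, h2, h3]
  have hcone : ∀ {z : K × F × F} (hz : z ≠ 0), Projectivization.mk K z hz ∈ projCone V {p |
      ∃ c : Fin 4 → K, p.rep = ∑ i, c i • v i ∧
        c 0 * c 1 + (α * c 2 ^ 2 + β * c 2 * c 3 + γ * c 3 ^ 2) = 0} ↔ Q z = 0 := by
    intro z hz
    rw [mk_mem_projCone hv]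
    constructor
    · rintro ⟨c, k, rfl, hc⟩
      rw [hQc, hc]
    · intro h
      refine ⟨_, _, hexp z, ?_⟩
      rw [← h, hQ]
      rfl
  have huw' : (![0, t₀ * u, t₀ * w] : Fin 3 → F) ≠ 0 := by
    intro h
    apply huw
    have h1 := congrFun h 1
    have h2 := congrFun h 2
    simp [ht₀'] at h1 h2
    simp [h1, h2]
  refine ⟨Q, t₀ * u, t₀ * w, huw', ?_, ?_, ?_⟩
  · intro x y
    by_cases hz : ((0 : K), x, y) = 0
    · simp only [Prod.mk_eq_zero, true_and] at hz
      obtain ⟨rfl, rfl⟩ := hz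
      refine iff_of_true ?_ ⟨0, by simp, by simp⟩
      exact QuadraticMap.map_zero Q
    · have h1 : Projectivization.mk K _ hz ∈ projCone V _ ∩ solidAtInfinity K F ↔ _ :=
        Set.ext_iff.1 hinf (Projectivization.mk K _ hz)
      rw [Set.mem_inter_iff, hcone, mk_mem_solidAtInfinity, mk_mem_spreadLine] at h1
      simp only [and_true, Prod.mk.injEq, true_and] at h1
      rw [h1]
      constructor
      · rintro ⟨t, rfl, rfl⟩
        exact ⟨t / t₀, by field_simp, by field_simp⟩
      · rintro ⟨t, rfl, rfl⟩
        exact ⟨t * t₀, by ring, by ring⟩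
  · intro z
    rw [← ht₀]
    constructor
    · intro h
      -- Testing on `0` and on the first two points of the frame determines the coordinates of `z`.
      have hz := hexp z
      refine ⟨B.coord 0 z, ?_⟩
      set c : Fin 4 → K := fun i => B.coord i.succ z with hc
      have key : ∀ d : Fin 4 → K, (c 0 + d 0) * (c 1 + d 1)
          + (α * (c 2 + d 2) ^ 2 + β * (c 2 + d 2) * (c 3 + d 3) + γ * (c 3 + d 3) ^ 2)
          = d 0 * d 1 + (α * d 2 ^ 2 + β * d 2 * d 3 + γ * d 3 ^ 2) := by
        intro d
        have h1 := h (∑ i, d i • v i + (0 : K) • V.rep)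
        rw [hQc] at h1
        rw [← h1, ← hQc (fun i => c i + d i) (B.coord 0 z)]
        congr 1
        conv_rhs => rw [hz]
        simp only [add_smul, Finset.sum_add_distrib, zero_smul, add_zero, hc]
        abel
      have k0 := key 0
      have k1 := key (Pi.single 0 1)
      have k2 := key (Pi.single 1 1)
      simp at k0 k1 k2
      have c0 : c 0 = 0 := by linear_combination k2 - k0
      have c1 : c 1 = 0 := by linear_combination k1 - k0
      obtain ⟨c2, c3⟩ := hf (c 2) (c 3) (by rw [c0] at k0; linear_combination k0)
      have hsum : ∑ i, c i • v i = 0 := by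
        rw [Fin.sum_univ_four, c0, c1, c2, c3]
        simp
      conv_lhs => rw [hz]
      rw [hsum, zero_add]
    · rintro ⟨k, rfl⟩ z'
      conv_lhs => rw [hexp z', add_assoc, ← add_smul, hQc]
      conv_rhs => rw [hexp z', hQc]
  · have hmk : Projectivization.mk F ![0, u, w] huw = Projectivization.mk F _ huw' := by
      refine (Projectivization.mk_eq_mk_iff' _ _ _ _ _).2 ⟨t₀⁻¹, ?_⟩
      ext i
      fin_cases i <;> simp [ht₀']
    rw [hmk]
    congr 1
    ext p
    simp only [Set.mem_ofPred_eq, bruckBosePt, hcone]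

/-- A linear automorphism of the plane moves a given nonzero vector to `(0, 1)`. -/
lemma exists_linearEquiv {u w : F} (h : (![0, u, w] : Fin 3 → F) ≠ 0) :
    ∃ G : (F × F) ≃ₗ[F] (F × F), G (u, w) = (0, 1) := by
  by_cases hw : w = 0
  · have hu : u ≠ 0 := by
      rintro rfl
      exact h (by rw [hw]; ext i; fin_cases i <;> rfl)
    refine ⟨{ toFun := fun p => (p.2, p.1 / u)
              invFun := fun p => (p.2 * u, p.1)
              map_add' := fun p p' => by simp [add_div]
              map_smul' := fun c p => by simp [mul_div_assoc]
              left_inv := fun p => by simp [hu]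
              right_inv := fun p => by simp [hu] }, ?_⟩
    simp [hw, hu]
  · refine ⟨{ toFun := fun p => (p.1 - p.2 / w * u, p.2 / w)
              invFun := fun p => (p.1 + p.2 * u, p.2 * w)
              map_add' := fun p p' => by
                ext
                · simp [add_div, add_mul]
                  ring
                · simp [add_div]
              map_smul' := fun c p => by
                ext <;> simp [mul_div_assoc, mul_sub, mul_assoc]
              left_inv := fun p => by simp [hw]
              right_inv := fun p => by simp [hw] }, ?_⟩
    simp [hw]

/-- The automorphism `(v₀, v) ↦ (v₀, G v)`. -/
def extendAffine (G : (F × F) ≃ₗ[F] (F × F)) : (Fin 3 → F) ≃ₗ[F] (Fin 3 → F) where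
  toFun v := ![v 0, (G (v 1, v 2)).1, (G (v 1, v 2)).2]
  invFun v := ![v 0, (G.symm (v 1, v 2)).1, (G.symm (v 1, v 2)).2]
  map_add' v v' := by
    have : G (v 1 + v' 1, v 2 + v' 2) = G (v 1, v 2) + G (v' 1, v' 2) :=
      map_add G (v 1, v 2) (v' 1, v' 2)
    ext i
    fin_cases i <;> simp [this]
  map_smul' c v := by
    have : G (c * v 1, c * v 2) = c • G (v 1, v 2) :=
      map_smul G c (v 1, v 2)
    ext i
    fin_cases i <;> simp [this]
  left_inv v := by
    ext i
    fin_cases i <;> simp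
  right_inv v := by
    ext i
    fin_cases i <;> simp

lemma projectivity_extendAffine (G : (F × F) ≃ₗ[F] (F × F)) (x y : F) :
    projectivity (extendAffine G) (affPt x y) = affPt (G (x, y)).1 (G (x, y)).2 := by
  rw [affPt, projectivity_mk, affPt]
  rfl

/-- Up to a projectivity, the vertex of the cone is `(0, 0, 1)`. -/
lemma exists_quadraticForm_of_isBuekenhoutMetzSet_vertex (hF : Module.finrank K F = 2)
    {U : Set (PG2 F)} (hU : IsBuekenhoutMetzSet K U) :
    ∃ (Q : QuadraticForm K (K × F × F)) (g : (Fin 3 → F) ≃ₗ[F] (Fin 3 → F)),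
      (∀ x y, Q (0, x, y) = 0 ↔ x = 0) ∧
      (∀ z, (∀ z', Q (z' + z) = Q z') ↔ ∃ k : K, z = (0, 0, algebraMap K F k)) ∧
      projectivity g '' U = {p | ∃ x y : F, p = affPt x y ∧ Q (1, x, y) = 0} ∪ {yInf F} := by
  obtain ⟨Q, u, w, huw, hinf, hrad, rfl⟩ := exists_quadraticForm_of_isBuekenhoutMetzSet hF hU
  obtain ⟨G, hG⟩ := exists_linearEquiv huw
  have hG' : G.symm (0, 1) = (u, w) := by rw [← hG, LinearEquiv.symm_apply_apply]
  let E : (K × F × F) ≃ₗ[K] (K × F × F) :=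
    (LinearEquiv.refl K K).prodCongr (G.symm.restrictScalars K)
  have hE : ∀ (t : K) (p : F × F), E (t, p) = (t, G.symm p) := fun t p => rfl
  refine ⟨Q.comp E.toLinearMap, extendAffine G, ?_, ?_, ?_⟩
  · intro x y
    rw [QuadraticMap.comp_apply, LinearEquiv.coe_coe, hE, ← Prod.mk.eta (p := G.symm (x, y)),
      hinf]
    constructor
    · rintro ⟨t, h1, h2⟩
      have h3 : G.symm (x, y) = t • G.symm (0, 1) := by
        rw [hG']
        exact Prod.ext h1 h2
      rw [← map_smul] at h3
      have h4 := G.symm.injective h3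
      simpa using congrArg Prod.fst h4
    · rintro rfl
      have h3 : G.symm (0, y) = y • G.symm (0, 1) := by
        rw [← map_smul]
        simp
      rw [h3, hG']
      exact ⟨y, rfl, rfl⟩
  · intro z
    have h1 : (∀ z', (Q.comp E.toLinearMap) (z' + z) = (Q.comp E.toLinearMap) z') ↔
        ∀ z', Q (z' + E z) = Q z' := by
      simp only [QuadraticMap.comp_apply, LinearEquiv.coe_coe, map_add]
      exact E.surjective.forall (p := fun z' => Q (z' + E z) = Q z') |>.symm
    rw [h1, hrad]
    refine exists_congr fun k => ?_
    have h2 : k • ((0 : K), u, w) = E (0, 0, algebraMap K F k) := by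
      have : (((0 : F), algebraMap K F k) : F × F) = algebraMap K F k • ((0 : F), (1 : F)) := by
        rw [Prod.smul_mk, smul_zero, smul_eq_mul, mul_one]
      rw [hE, this, map_smul, hG', algebraMap_smul, Prod.smul_mk, smul_zero]
    rw [h2, E.injective.eq_iff]
  · rw [Set.image_union, Set.image_singleton]
    congr 1
    · ext p
      constructor
      · rintro ⟨_, ⟨x, y, rfl, hQ⟩, rfl⟩
        refine ⟨_, _, projectivity_extendAffine G x y, ?_⟩
        rwa [QuadraticMap.comp_apply, LinearEquiv.coe_coe, hE, Prod.mk.eta,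
          LinearEquiv.symm_apply_apply]
      · rintro ⟨x, y, rfl, hQ⟩
        refine ⟨affPt (G.symm (x, y)).1 (G.symm (x, y)).2, ⟨_, _, rfl, hQ⟩, ?_⟩
        rw [projectivity_extendAffine, Prod.mk.eta, LinearEquiv.apply_symm_apply]
    · rw [Set.singleton_eq_singleton_iff, projectivity_mk]
      refine mk_eq_yInf _ rfl ?_
      simp [extendAffine, hG]

variable [Fintype K]

/-- Every `K`-valued quadratic form on the plane `F` over `K` is `x ↦ φ (a x² + b x^{q+1})`. In
the coordinates of `x` with respect to `1, e`, and with `b ∈ K e`, this is a linear system of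
three equations whose determinant is the discriminant of the minimal polynomial of `e`. -/
lemma exists_quadForm_eq (hF : Module.finrank K F = 2) {e : F} {φ : F →ₗ[K] K} (he : φ e = 1)
    (hk : ∀ k, φ (algebraMap K F k) = 0) (hy : ∀ y, ∃ k, y = algebraMap K F k + φ y • e)
    (N : QuadraticForm K F) : ∃ a b, ∀ x, N x = φ (a * x ^ 2 + b * x ^ (Fintype.card K + 1)) := by
  obtain ⟨T, hT⟩ := exists_trace (K := K) hF e
  obtain ⟨n, hn⟩ := exists_norm (K := K) hF e
  have hD : T ^ 2 - 4 * n ≠ 0 := by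
    intro h
    have h1 : (e ^ Fintype.card K - e) ^ 2 = 0 := by
      rw [← map_zero (algebraMap K F), ← h]
      simp only [map_sub, map_pow, map_mul, hT, hn, map_ofNat, pow_succ e]
      ring
    have h2 := (mem_range_iff e).2 (sub_eq_zero.1 (pow_eq_zero_iff two_ne_zero |>.1 h1))
    rw [mem_range_iff_coord hk hy, he] at h2
    exact one_ne_zero h2
  set α := N 1
  set β := QuadraticMap.polar N 1 e
  set γ := N e
  let A0 := ((T ^ 2 - 2 * n) * (β - T * α) - T * (γ - n * α)) / (T ^ 2 - 4 * n)
  let A1 := (2 * (γ - n * α) - T * (β - T * α)) / (T ^ 2 - 4 * n)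
  have hA0 : A0 * (T ^ 2 - 4 * n) = _ := div_mul_cancel₀ _ hD
  have hA1 : A1 * (T ^ 2 - 4 * n) = _ := div_mul_cancel₀ _ hD
  have e1 : 2 * A0 + T * A1 = β - T * α := by
    apply mul_right_cancel₀ hD
    linear_combination 2 * hA0 + T * hA1
  have e2 : T * A0 + (T ^ 2 - 2 * n) * A1 = γ - n * α := by
    apply mul_right_cancel₀ hD
    linear_combination T * hA0 + (T ^ 2 - 2 * n) * hA1
  refine ⟨algebraMap K F A0 + algebraMap K F A1 * e, algebraMap K F (α - A1) * e, fun x => ?_⟩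
  obtain ⟨s, hs⟩ := hy x
  set t := φ x
  have hN : N x = α * s ^ 2 + β * s * t + γ * t ^ 2 := by
    rw [hs, Algebra.algebraMap_eq_smul_one, QuadraticMap.map_add N]
    simp only [QuadraticMap.map_smul, QuadraticMap.polar_smul_left,
      QuadraticMap.polar_smul_right, smul_eq_mul, α, β, γ]
    ring
  have hval : (algebraMap K F A0 + algebraMap K F A1 * e) * x ^ 2
      + algebraMap K F (α - A1) * e * x ^ (Fintype.card K + 1)
      = algebraMap K F (A0 * (s ^ 2 - t ^ 2 * n) - n * A1 * (2 * s * t + t ^ 2 * T))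
      + (A0 * (2 * s * t + t ^ 2 * T) + A1 * (s ^ 2 - t ^ 2 * n)
        + A1 * T * (2 * s * t + t ^ 2 * T) + (α - A1) * (s ^ 2 + s * t * T + t ^ 2 * n)) • e := by
    rw [pow_succ x (Fintype.card K), hs, pow_card_add, Algebra.smul_def, Algebra.smul_def, mul_pow,
      pow_card_algebraMap, pow_card_algebraMap]
    rw [pow_succ] at hn
    simp only [map_add, map_sub, map_mul, map_pow, map_ofNat, hT, hn]
    ring
  rw [hval, map_add, hk, map_smul, he, hN]
  simp only [smul_eq_mul]
  linear_combination (-(s * t)) * e1 - t ^ 2 * e2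

lemma exists_linearMap_eq (hF : Module.finrank K F = 2) {e : F} {φ : F →ₗ[K] K} (he : φ e = 1)
    (hk : ∀ k, φ (algebraMap K F k) = 0) (hy : ∀ y, ∃ k, y = algebraMap K F k + φ y • e)
    (μ : F →ₗ[K] K) : ∃ m, ∀ x, μ x = φ (m * x) := by
  obtain ⟨T, hT⟩ := exists_trace (K := K) hF e
  obtain ⟨n, hn⟩ := exists_norm (K := K) hF e
  rw [pow_succ] at hn
  refine ⟨algebraMap K F (μ e - μ 1 * T) + algebraMap K F (μ 1) * e, fun x => ?_⟩
  obtain ⟨s, hs⟩ := hy x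
  set t := φ x
  have hval : (algebraMap K F (μ e - μ 1 * T) + algebraMap K F (μ 1) * e) * x
      = algebraMap K F ((μ e - μ 1 * T) * s - μ 1 * t * n)
        + (s * μ 1 + t * μ e) • e := by
    rw [hs, Algebra.smul_def, Algebra.smul_def]
    simp only [map_add, map_sub, map_mul, hT, hn]
    ring
  rw [hval, map_add, hk, map_smul, he, hs, map_add, map_smul, Algebra.algebraMap_eq_smul_one,
    map_smul]
  simp only [smul_eq_mul]
  ring

/-- Since `Q` has no zeros with `x ≠ 0` at infinity, it has no terms in `y` except `c t φ(y)`;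
solving `Q(1, x, y) = 0` for `φ (y)` gives the equation of `U_{a,b}`, up to a shear. -/
lemma exists_equation (hF : Module.finrank K F = 2) (Q : QuadraticForm K (K × F × F))
    (hinf : ∀ x y, Q (0, x, y) = 0 ↔ x = 0)
    (hrad : ∀ z, (∀ z', Q (z' + z) = Q z') ↔ ∃ k : K, z = (0, 0, algebraMap K F k)) :
    ∃ a b m d : F, Anisotropic K a b ∧ ∀ x y, Q (1, x, y) = 0 ↔
      y - a * x ^ 2 - b * x ^ (Fintype.card K + 1) - m * x - d ∈ Set.range (algebraMap K F) := by
  obtain ⟨e, φ, he, hk, hy⟩ := exists_coord hF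
  let P := QuadraticMap.polar Q
  have hQe : Q (0, 0, e) = 0 := (hinf 0 e).2 rfl
  have hPe : ∀ z, P z (0, 0, e) = Q (z + (0, 0, e)) - Q z := by
    intro z
    simp only [P, QuadraticMap.polar, hQe, sub_zero]
  have hQy : ∀ t x y, Q (t, x, y) = Q (t, x, 0) + φ y * P (t, x, 0) (0, 0, e) := by
    intro t x y
    obtain ⟨k, hky⟩ := hy y
    have h1 : (t, x, y) = ((t, x, 0) + φ y • (0, 0, e)) + (0, 0, algebraMap K F k) := by
      conv_lhs => rw [hky]
      simp [add_comm]
    rw [h1, (hrad _).2 ⟨k, rfl⟩, QuadraticMap.map_add Q, QuadraticMap.map_smul, hQe,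
      QuadraticMap.polar_smul_right, smul_zero, add_zero, smul_eq_mul]
  have hP0 : ∀ x, P (0, x, 0) (0, 0, e) = 0 := by
    intro x
    by_contra h
    -- Otherwise `Q (0, x, y) = 0` is solvable for `φ (y)`.
    have h1 := hQy 0 x ((-Q (0, x, 0) / P (0, x, 0) (0, 0, e)) • e)
    rw [map_smul, he, smul_eq_mul, mul_one, div_mul_cancel₀ _ h, add_neg_cancel, hinf] at h1
    subst h1
    exact h (QuadraticMap.polar_zero_left Q _)
  have hPt : ∀ t x, P (t, x, 0) (0, 0, e) = t * P (1, 0, 0) (0, 0, e) := by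
    intro t x
    have h1 : ((t, x, 0) : K × F × F) = t • (1, 0, 0) + (0, x, 0) := by simp
    change QuadraticMap.polar Q _ _ = _
    rw [h1, QuadraticMap.polar_add_left, QuadraticMap.polar_smul_left, smul_eq_mul]
    change t * P _ _ + P _ _ = _
    rw [hP0, add_zero]
  set c := P (1, 0, 0) (0, 0, e) with hc
  have hc0 : c ≠ 0 := by
    intro h
    -- Otherwise `(0, 0, e)` lies in the radical of `Q`.
    obtain ⟨k, hke⟩ := (hrad (0, 0, e)).1 (by
      rintro ⟨t, x, y⟩
      rw [Prod.mk_add_mk, Prod.mk_add_mk, add_zero, add_zero, hQy, hQy t x y, hPt, h]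
      simp)
    simp only [Prod.mk.injEq, true_and] at hke
    rw [hke, hk] at he
    exact zero_ne_one he
  let ι : F →ₗ[K] K × F × F := LinearMap.inr K K (F × F) ∘ₗ LinearMap.inl K F F
  have hι : ∀ x, ι x = (0, x, 0) := fun x => rfl
  obtain ⟨a, b, hab⟩ := exists_quadForm_eq hF he hk hy ((-c⁻¹) • Q.comp ι)
  obtain ⟨m, hm⟩ := exists_linearMap_eq hF he hk hy
    ((-c⁻¹) • (QuadraticMap.polarBilin Q (1, 0, 0) ∘ₗ ι))
  refine ⟨a, b, m, (-c⁻¹ * Q (1, 0, 0)) • e, ?_, fun x y => ?_⟩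
  · intro x hx hmem
    rw [mem_range_iff_coord hk hy, ← hab, smul_apply, QuadraticMap.comp_apply, hι,
      smul_eq_mul, mul_eq_zero, hinf] at hmem
    exact hmem.elim (neg_ne_zero.2 (inv_ne_zero hc0)) hx
  · have h1 : Q (1, x, y) = Q (1, 0, 0) + Q (0, x, 0) + P (1, 0, 0) (0, x, 0) + c * φ y := by
      have h2 : ((1, x, 0) : K × F × F) = (1, 0, 0) + (0, x, 0) := by simp
      rw [hQy, hPt, h2, QuadraticMap.map_add Q]
      ring
    have h3 := hab x
    have h4 := hm x
    rw [smul_apply, QuadraticMap.comp_apply, hι, smul_eq_mul] at h3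
    rw [LinearMap.smul_apply, LinearMap.comp_apply, hι, QuadraticMap.polarBilin_apply_apply,
      smul_eq_mul] at h4
    rw [mem_range_iff_coord hk hy, sub_sub y, map_sub, map_sub, map_sub, ← h3, ← h4, map_smul, he,
      h1]
    change _ ↔ φ y - -c⁻¹ * Q (0, x, 0) - -c⁻¹ * P (1, 0, 0) (0, x, 0) - _ • (1 : K) = 0
    rw [smul_eq_mul]
    field_simp
    constructor <;> intro h <;> linear_combination h

/-- The shear `(v₀, v₁, v₂) ↦ (v₀, v₁, v₂ - m v₁ - d v₀)`. -/
def shear (m d : F) : (Fin 3 → F) ≃ₗ[F] (Fin 3 → F) where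
  toFun v := ![v 0, v 1, v 2 - m * v 1 - d * v 0]
  invFun v := ![v 0, v 1, v 2 + m * v 1 + d * v 0]
  map_add' v v' := by
    ext i
    fin_cases i <;> simp
    ring
  map_smul' c v := by
    ext i
    fin_cases i <;> simp
    ring
  left_inv v := by
    ext i
    fin_cases i <;> simp
    ring
  right_inv v := by
    ext i
    fin_cases i <;> simp
    ring

lemma projectivity_shear (m d x y : F) :
    projectivity (shear m d) (affPt x y) = affPt x (y - m * x - d) := by
  rw [affPt, projectivity_mk, affPt]
  congr 1
  simp [shear]

/-- Every B-M unital is projectively equivalent to some `U_{a,b}`, where the quadratic form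
`x ↦ a x² + b x^{q+1}` is anisotropic modulo `K`. -/
theorem exists_image_bmSet_of_isBMUnital (hF : Module.finrank K F = 2) {U : Set (PG2 F)}
    (hU : IsBMUnital K U) : ∃ (a b : F) (g : (Fin 3 → F) ≃ₗ[F] (Fin 3 → F)),
      Anisotropic K a b ∧ projectivity g '' bmSet K a b = U := by
  obtain ⟨g₁, hU⟩ := hU
  obtain ⟨Q, g₂, hinf, hrad, hQ⟩ := exists_quadraticForm_of_isBuekenhoutMetzSet_vertex hF hU
  obtain ⟨a, b, m, d, hab, heq⟩ := exists_equation hF Q hinf hrad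
  have hshear : projectivity (shear m d) '' (projectivity g₂ '' (projectivity g₁ '' U))
      = bmSet K a b := by
    have hinfty : projectivity (shear m d) (yInf F) = yInf F := by
      rw [yInf, projectivity_mk]
      refine mk_eq_yInf _ ?_ ?_ <;> simp [shear]
    rw [hQ, Set.image_union, Set.image_singleton, hinfty]
    ext p
    constructor
    · rintro (⟨_, ⟨x, y, rfl, h⟩, rfl⟩ | hp)
      · rw [projectivity_shear, affPt_mem_bmSet]
        convert (heq x y).1 h using 1
        ring
      · exact Or.inr hp
    · rintro (⟨x, r, rfl⟩ | hp)
      · refine Or.inl ⟨affPt x (a * x ^ 2 + b * x ^ (Fintype.card K + 1) + algebraMap K F r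
          + m * x + d), ⟨_, _, rfl, (heq _ _).2 ⟨r, by ring⟩⟩, ?_⟩
        rw [projectivity_shear]
        congr 1
        ring
      · exact Or.inr hp
  refine ⟨a, b, ((g₁.trans g₂).trans (shear m d)).symm, hab, ?_⟩
  rw [← hshear, ← projectivity_trans_image g₁, ← projectivity_trans_image (g₁.trans g₂),
    projectivity_symm_image]

end NormalForm

end BMUnital

open BMUnital in
theorem theorem3p4 (K F : Type*) [Field K] [Fintype K] [Field F] [Algebra K F]
    (hF : Module.finrank K F = 2) :
    (∀ a b : F, a ≠ 0 → b ∉ Set.range (algebraMap K F) → EbertCondition K a b →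
      IsClassicalUnital K (classicalSet K b) ∧
      IsUnital (Fintype.card K) (closureLines (parabolaPlane a)) (classicalSetInClosure K a b) ∧
      ∃ Φ : ClosurePoint (parabolaPlane a) ≃ PG2 F, IsCoordinatization a Φ ∧
        Φ '' classicalSetInClosure K a b = bmSet K (-a) b ∧
        IsBMUnital K (bmSet K (-a) b) ∧
        ¬ IsClassicalUnital K (bmSet K (-a) b)) ∧
    (∀ U : Set (PG2 F), IsBMUnital K U → ¬ IsClassicalUnital K U → ¬ IsHSzType K U →
      ∃ a b : F, a ≠ 0 ∧ b ∉ Set.range (algebraMap K F) ∧ EbertCondition K a b ∧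
        ∃ Φ : ClosurePoint (parabolaPlane a) ≃ PG2 F, IsCoordinatization a Φ ∧
          ∃ g : (Fin 3 → F) ≃ₗ[F] (Fin 3 → F),
            projectivity g '' (Φ '' classicalSetInClosure K a b) = U) := by
  constructor
  · intro a b ha hb hab
    rw [ebertCondition_iff hF] at hab
    exact ⟨bmSet_zero_left (K := K) b ▸ isClassicalUnital_bmSet_zero hF hb,
      isUnital_classicalSetInClosure hF hab, coordinatization a, isCoordinatization,
      coordinatization_image a b, isBMUnital_bmSet hF (hab.neg_left hF),
      not_isClassicalUnital_bmSet hF (hab.two_lt_card hF ha hb) (neg_ne_zero.2 ha)⟩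
  · intro U hU hcl hHSz
    obtain ⟨a, b, g, hab, rfl⟩ := exists_image_bmSet_of_isBMUnital hF hU
    have ha : a ≠ 0 := by
      rintro rfl
      exact hcl (isClassicalUnital_image hF (isClassicalUnital_bmSet_zero hF
        ((anisotropic_zero_left_iff hF b).1 hab)) g)
    have hb : b ∉ Set.range (algebraMap K F) := by
      rintro ⟨k, rfl⟩
      rcases Nat.even_or_odd (Fintype.card K) with hq | hq
      · exact ((((ebertCondition_iff hF _ _).2 hab).2 hq).1 ⟨k, rfl⟩)
      · exact hHSz (isHSzType_image hF hq ha k g hU)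
    refine ⟨-a, b, neg_ne_zero.2 ha, hb, (ebertCondition_iff hF _ _).2 (hab.neg_left hF),
      coordinatization (-a), isCoordinatization, g, ?_⟩
    rw [coordinatization_image, neg_neg]
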